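/- Let $q$ be a complex number with $0<|q|<1$ and let $x$ be a nonzero complex number. Write $(x)_n=\prod_{i=0}^{n-1}(1-xq^i)$, $(x)_\infty=\prod_{i\ge 0}(1-xq^i)$, $(q)_n=(q;q)_n$, $(q)_\infty=(q;q)_\infty$, $\Theta(x;q)=(x)_\infty(q/x)_\infty(q)_\infty$, and $\mathrm{sg}(r,s)=\tfrac12(\mathrm{sg}(r)+\mathrm{sg}(s))$, where $\mathrm{sg}(r)=1$ for $r\ge 0$ and $\mathrm{sg}(r)=-1$ for $r<0$. For integers $t\ge 1$, $1\le m\le t$, and $b\in\{0,1\}$ let $$\mathcal U_t^{(m)}(x;q)=\sum_{n\ge 0}q^n(-x)_n(-q/x)_nH_n(t,m;0;q),$$ $$H_n(t,m;b;q)=\sum_{n=n_t\ge\cdots\ge n_1\ge 0}\ \prod_{j=1}^{t-1}q^{n_j^2+(1-b)n_j}\begin{bmatrix}n_{j+1}-n_j-bj+\sum_{r=1}^{j}(2n_r+\chi_{m>r})\\ n_{j+1}-n_j\end{bmatrix}_q,$$ where $\chi_A$ is $1$ if $A$ is true and $0$ otherwise, and where the Gaussian polynomial $\begin{bmatrix}n\\k\end{bmatrix}_q$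 is $\frac{(q)_n}{(q)_k(q)_{n-k}}$ for $0\le k\le n$ and $0$ otherwise. Put $\mathcal U(x;q)=\mathcal U_1^{(1)}(x;q)$. Let $$\theta_{p,m}^{[t]}=\sum_{r\equiv s\,(2)}\mathrm{sg}(r,s)(-1)^{\frac{r-s}2}q^{B^{[t]}_{p,m}(r,s)},\qquad B^{[t]}_{p,m}(r,s)=\tfrac{r^2}8+\tfrac{4t-1}4rs+\tfrac{s^2}8+\tfrac{4p-1-2m}4r+\tfrac{1+2m}4s,$$ $$f_{t,m}(x)=\frac{\Theta(x;q)}{(q)_\infty^3}\sum_{r\equiv s\,(2)}\mathrm{sg}(r,s)\frac{(-1)^{\frac{r-s}2}q^{B^{[t]}_{t,m}(r,s)}}{1-xq^{\frac{r+s}2}}\qquad(x\notin q^{\mathbb Z}),$$ $$f_{a,b,c}(x,y;q)=\sum_{r,s\in\mathbb Z}\mathrm{sg}(r,s)(-1)^{r+s}x^ry^sq^{a\binom r2+brs+c\binom s2},$$ the sums over $r\equiv s\,(2)$ being over all $(r,s)\in\mathbb Z^2$ with $r\equiv s\pmod 2$. Then the series defining $\mathcal U(-x;q)$, $f_{1,2,3}(x^{-1}q^2,q^3;q)$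 and $\theta_{1,1}^{[2]}$ converge absolutely, and so does the double series in $f_{2,1}(x)$ if $x\notin q^{\mathbb Z}=\{q^k:k\in\mathbb Z\}$. For every $x\notin q^{\mathbb Z}$, $$\mathcal U(-x;q)=f_{2,1}(x)=\frac1{(q)_\infty}f_{1,2,3}(x^{-1}q^2,q^3;q).$$ For every $x\neq 0$ one has $\mathcal U(-x;q)=\frac1{(q)_\infty}f_{1,2,3}(x^{-1}q^2,q^3;q)$ and $\lim_{y\to x,\,y\ne x}f_{2,1}(y)=\mathcal U(-x;q)$, so that the singularities of $f_{2,1}$ at the points of $q^{\mathbb Z}$ are removable and the identity persists there. Moreover, $\theta_{1,1}^{[2]}=(q)_\infty^2$. -/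

import Mathlib

namespace UFunction

/-- The finite q-Pochhammer symbol `(x;q)_n = ∏_{i=0}^{n-1} (1 - x q^i)`. -/
noncomputable def qPoch (x q : ℂ) (n : ℕ) : ℂ := ∏ i ∈ Finset.range n, (1 - x * q ^ i)

/-- The infinite q-Pochhammer symbol `(x;q)_∞ = ∏_{i ≥ 0} (1 - x q^i)`. -/
noncomputable def qPochInf (x q : ℂ) : ℂ := ∏' i : ℕ, (1 - x * q ^ i)

/-- The product defining `(x;q)_∞` converges for `|q| < 1`. -/
theorem multipliable_qPochInf (x : ℂ) {q : ℂ} (hq : ‖q‖ < 1) :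
    Multipliable fun i : ℕ => 1 - x * q ^ i := by
  have h : Summable fun i : ℕ => ‖-(x * q ^ i)‖ := by
    simp only [norm_neg, norm_mul, norm_pow]
    exact (summable_geometric_of_lt_one (norm_nonneg q) hq).mul_left _
  simpa [sub_eq_add_neg] using multipliable_one_add_of_summable h

/-- The Gaussian polynomial `[n, k]_q`, equal to `0` unless `0 ≤ k ≤ n`. -/
noncomputable def gaussBinom (q : ℂ) (n k : ℤ) : ℂ :=
  if 0 ≤ k ∧ k ≤ n then
    qPoch q q n.toNat / (qPoch q q k.toNat * qPoch q q (n - k).toNat)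
  else 0

/-- The integer sequences `n = n_t ≥ n_{t-1} ≥ ⋯ ≥ n_1 ≥ 0`; here `ν i` is `n_{i+1}`. -/
def chains (t n : ℕ) : Finset (Fin t → ℕ) :=
  (Fintype.piFinset fun _ => Finset.range (n + 1)).filter fun ν =>
    (∀ i j : Fin t, i ≤ j → ν i ≤ ν j) ∧ ∀ i : Fin t, (i : ℕ) + 1 = t → ν i = n

/-- The polynomials `H_n(t, m; b; q)`, for `t ≥ 1`, `1 ≤ m ≤ t`, `b ∈ {0, 1}`:
`∑_{n = n_t ≥ ⋯ ≥ n_1 ≥ 0} ∏_{j=1}^{t-1} q^{n_j^2 + (1-b) n_j}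
  [n_{j+1} - n_j - b j + ∑_{r=1}^{j} (2 n_r + χ_{m > r}), n_{j+1} - n_j]_q`.
The product index below is `j - 1` and the inner summation index is `r - 1`. -/
noncomputable def H (n t m b : ℕ) (q : ℂ) : ℂ :=
  ∑ ν ∈ chains t n, ∏ j : Fin (t - 1),
    let lo : Fin t := ⟨j, by omega⟩
    let hi : Fin t := ⟨j + 1, by omega⟩
    q ^ (ν lo ^ 2 + (1 - b) * ν lo) *
      gaussBinom q
        ((ν hi : ℤ) - ν lo - b * ((j : ℤ) + 1) +
          ∑ r ∈ Finset.univ.filter (fun r : Fin t => r ≤ lo),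
            (2 * (ν r : ℤ) + if m > (r : ℕ) + 1 then 1 else 0))
        ((ν hi : ℤ) - ν lo)

/-- The `n`-th term of the series `𝒰_t^{(m)}(x;q)`. -/
noncomputable def UTerm (t m : ℕ) (x q : ℂ) (n : ℕ) : ℂ :=
  q ^ n * qPoch (-x) q n * qPoch (-q / x) q n * H n t m 0 q

/-- `𝒰_t^{(m)}(x;q) = ∑_{n ≥ 0} q^n (-x)_n (-q/x)_n H_n(t, m; 0; q)`. -/
noncomputable def U (t m : ℕ) (x q : ℂ) : ℂ := ∑' n : ℕ, UTerm t m x q n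

/-- `sg(r) = 1` for `r ≥ 0` and `sg(r) = -1` for `r < 0`. -/
def sg (r : ℤ) : ℤ := if 0 ≤ r then 1 else -1

/-- `sg(r, s) = (sg(r) + sg(s)) / 2`. -/
noncomputable def sg₂ (r s : ℤ) : ℂ := ((sg r : ℂ) + (sg s : ℂ)) / 2

/-- `Θ(x;q) = (x)_∞ (q/x)_∞ (q)_∞`. -/
noncomputable def Theta (x q : ℂ) : ℂ := qPochInf x q * qPochInf (q / x) q * qPochInf q q

/-- The exponent
`B_{p,m}(r,s) = r^2/8 + (4t-1)rs/4 + s^2/8 + (4p-1-2m)r/4 + (1+2m)s/4`,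
used only for `r ≡ s (mod 2)`, where the division by `8` is exact. -/
def B (t p m r s : ℤ) : ℤ :=
  (r ^ 2 + 2 * (4 * t - 1) * r * s + s ^ 2 + 2 * (4 * p - 1 - 2 * m) * r
    + 2 * (1 + 2 * m) * s) / 8

/-- The division in `B` is exact whenever `r ≡ s (mod 2)`. -/
theorem eight_mul_B (t p m : ℤ) {r s : ℤ} (h : r ≡ s [ZMOD 2]) :
    8 * B t p m r s = r ^ 2 + 2 * (4 * t - 1) * r * s + s ^ 2 + 2 * (4 * p - 1 - 2 * m) * r
      + 2 * (1 + 2 * m) * s := by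
  unfold B
  apply Int.mul_ediv_cancel'
  obtain ⟨d, hd⟩ := h.symm.dvd
  obtain rfl : r = s + 2 * d := by linarith
  obtain ⟨e, he⟩ := even_iff_two_dvd.mp (Int.even_mul_pred_self d)
  refine ⟨e - m * d + t * (s + 2 * d) * s + p * (s + 2 * d), ?_⟩
  linear_combination 4 * he

/-- The term of index `(r, s)` of the double series `g_{t,m}(x)`; its exponent is `B_{t,m}`. -/
noncomputable def gTerm (t m : ℤ) (x q : ℂ) (rs : ℤ × ℤ) : ℂ :=
  if rs.1 ≡ rs.2 [ZMOD 2] then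
    sg₂ rs.1 rs.2 * ((-1) ^ ((rs.1 - rs.2) / 2) * q ^ B t t m rs.1 rs.2) /
      (1 - x * q ^ ((rs.1 + rs.2) / 2))
  else 0

/-- `g_{t,m}(x)`, for `x` outside `{q^k : k ∈ ℤ}`. -/
noncomputable def g (t m : ℤ) (x q : ℂ) : ℂ := ∑' rs : ℤ × ℤ, gTerm t m x q rs

/-- `f_{t,m}(x) = Θ(x;q) / (q)_∞^3 * g_{t,m}(x)`, for `x` outside `{q^k : k ∈ ℤ}`. -/
noncomputable def f (t m : ℤ) (x q : ℂ) : ℂ := Theta x q / qPochInf q q ^ 3 * g t m x q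

/-- The term of index `(r, s)` of the indefinite theta series `θ_{p,m}` (with parameter `t`). -/
noncomputable def thetaTerm (t p m : ℤ) (q : ℂ) (rs : ℤ × ℤ) : ℂ :=
  if rs.1 ≡ rs.2 [ZMOD 2] then
    sg₂ rs.1 rs.2 * (-1) ^ ((rs.1 - rs.2) / 2) * q ^ B t p m rs.1 rs.2
  else 0

/-- The indefinite binary theta series `θ_{p,m}` (with parameter `t`). -/
noncomputable def theta (t p m : ℤ) (q : ℂ) : ℂ := ∑' rs : ℤ × ℤ, thetaTerm t p m q rs

/-- The term of index `(r, s)` of the Hecke-type double-sum `f_{a,b,c}(x, y; q)`. -/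
noncomputable def heckeTerm (a b c : ℤ) (x y q : ℂ) (rs : ℤ × ℤ) : ℂ :=
  sg₂ rs.1 rs.2 * (-1) ^ (rs.1 + rs.2) * x ^ rs.1 * y ^ rs.2 *
    q ^ (a * (rs.1 * (rs.1 - 1) / 2) + b * rs.1 * rs.2 + c * (rs.2 * (rs.2 - 1) / 2))

/-- The Hecke-type double-sum
`f_{a,b,c}(x,y;q) = ∑_{r,s} sg(r,s) (-1)^{r+s} x^r y^s q^{a C(r,2) + b r s + c C(s,2)}`. -/
noncomputable def hecke (a b c : ℤ) (x y q : ℂ) : ℂ := ∑' rs : ℤ × ℤ, heckeTerm a b c x y q rs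

end UFunction

namespace UFunction

open Filter Topology

/-! For `t = m = 1` the factor `H` is 1, so the series is `𝒰(-x) = ∑ q^n (x)_n (q/x)_n`. It is
evaluated in two independent ways.

Hecke form. The finite Jacobi triple product (`hasSum_tripleTerm`) expands `(x)_n (q/x)_n` in powers
of `x` with coefficients `[2n, n+k]`. After exchanging the sums, the coefficient of `x^k` involves
`∑_m q^m [2m+N, m]` with `N = 2|k|`. A telescoping sum of Gaussian binomials shows that `(q)_∞`
times this series satisfies the same three-step recursion in `N` as a partial theta series, and
boundedness forces equality (`qPochInf_mul_diagSum`). The partial theta series are exactly the rows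
of `f_{1,2,3}`.

Appell form. The constant sequence `β_n = 1` belongs to a Bailey pair relative to `q` whose `α_n`
contains a truncated theta series (`inverseSum_eq`, `sum_alpha`). Pairing it with the conjugate
Bailey pair given by the `q`-Gauss sum (`hasSum_conjugate_bailey`) turns `𝒰(-x)` into a product
times `∑ α_r q^r / ((1 - x q^r)(1 - q^{r+1}/x))`. In the coordinates `n = (r+s)/2` and `j =
±(r-s)/2` the series `g_{2,1}` has rows that are truncated theta series, and a partial fraction
identity merges rows `n` and `-n-1` into this same sum.

The theta constant comes from the same pair: `θ_{1,1}` equals `∑ α_r` (up to normalization of `α`),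
and letting `n → ∞` in the Bailey relation evaluates that sum as `(q)_∞^2`. The singularities are
removable because `𝒰` is continuous on `x ≠ 0` and the powers of `q` do not accumulate there. -/

theorem qPoch_zero (x q : ℂ) : qPoch x q 0 = 1 := by simp [qPoch]

theorem qPoch_succ (x q : ℂ) (n : ℕ) : qPoch x q (n + 1) = qPoch x q n * (1 - x * q ^ n) := by
  simp [qPoch, Finset.prod_range_succ]

theorem qPoch_self_succ (q : ℂ) (n : ℕ) :
    qPoch q q (n + 1) = qPoch q q n * (1 - q ^ (n + 1)) := by
  rw [qPoch_succ, pow_succ']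

theorem qPoch_add (x q : ℂ) (m n : ℕ) :
    qPoch x q (m + n) = qPoch x q m * qPoch (x * q ^ m) q n := by
  induction n with
  | zero => simp [qPoch_zero]
  | succ n ih => rw [← add_assoc, qPoch_succ, ih, qPoch_succ, pow_add]; ring

theorem one_sub_pow_succ_ne_zero {q : ℂ} (hq : ‖q‖ < 1) (n : ℕ) : 1 - q ^ (n + 1) ≠ 0 := by
  intro h
  have h1 : ‖q ^ (n + 1)‖ = 1 := by rw [← sub_eq_zero.mp h, norm_one]
  rw [norm_pow] at h1
  exact (pow_lt_one₀ (norm_nonneg q) hq n.succ_ne_zero).ne h1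

theorem one_sub_pow_ne_zero {q : ℂ} (hq : ‖q‖ < 1) {n : ℕ} (hn : n ≠ 0) : 1 - q ^ n ≠ 0 := by
  obtain ⟨m, rfl⟩ := Nat.exists_eq_succ_of_ne_zero hn
  exact one_sub_pow_succ_ne_zero hq m

theorem qPoch_self_ne_zero {q : ℂ} (hq : ‖q‖ < 1) (n : ℕ) : qPoch q q n ≠ 0 := by
  induction n with
  | zero => simp [qPoch_zero]
  | succ n ih => rw [qPoch_self_succ]; exact mul_ne_zero ih (one_sub_pow_succ_ne_zero hq n)

/-! ### Gaussian binomials. -/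

/-- Gaussian binomial coefficients by the `q`-Pascal recursion, with integer lower index. -/
noncomputable def qBinom (q : ℂ) : ℕ → ℤ → ℂ
  | 0, k => if k = 0 then 1 else 0
  | n + 1, k => qBinom q n (k - 1) + q ^ k * qBinom q n k

theorem qBinom_zero (q : ℂ) (k : ℤ) : qBinom q 0 k = if k = 0 then 1 else 0 := rfl

theorem qBinom_succ (q : ℂ) (n : ℕ) (k : ℤ) :
    qBinom q (n + 1) k = qBinom q n (k - 1) + q ^ k * qBinom q n k := rfl

theorem qBinom_of_neg (q : ℂ) (n : ℕ) {k : ℤ} (hk : k < 0) : qBinom q n k = 0 := by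
  induction n generalizing k with
  | zero => simp [qBinom_zero, hk.ne]
  | succ n ih => rw [qBinom_succ, ih hk, ih (by omega)]; simp

theorem qBinom_of_lt (q : ℂ) (n : ℕ) {k : ℤ} (hk : n < k) : qBinom q n k = 0 := by
  induction n generalizing k with
  | zero => rw [qBinom_zero, if_neg (by push_cast at hk; omega)]
  | succ n ih =>
    push_cast at hk
    rw [qBinom_succ, ih (by omega), ih (by omega)]; simp

/-- The mirror-image Pascal rule. Combining it with the defining rule drives both the triple product
recursion and the telescoping of the diagonal sums. -/
theorem qBinom_succ' {q : ℂ} (hq : q ≠ 0) (n : ℕ) (k : ℤ) :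
    qBinom q (n + 1) k = q ^ ((n : ℤ) + 1 - k) * qBinom q n (k - 1) + qBinom q n k := by
  induction n generalizing k with
  | zero =>
    rw [qBinom_succ]
    simp only [qBinom_zero]
    by_cases h0 : k = 0
    · simp [h0]
    · by_cases h1 : k = 1
      · simp [h1]
      · have : k - 1 ≠ 0 := by omega
        simp [h0, this]
  | succ n ih =>
    rw [qBinom_succ q (n + 1)]
    have a1 := ih (k - 1)
    have e1 : q ^ ((n : ℤ) + 1 - (k - 1)) = q ^ (((n + 1 : ℕ) : ℤ) + 1 - k) := by
      congr 1; push_cast; ring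
    have e2 : q ^ (((n + 1 : ℕ) : ℤ) + 1 - k) * q ^ (k - 1) = q ^ k * q ^ ((n : ℤ) + 1 - k) := by
      rw [← zpow_add₀ hq, ← zpow_add₀ hq]; congr 1; push_cast; ring
    rw [e1] at a1
    linear_combination a1 - q ^ (((n + 1 : ℕ) : ℤ) + 1 - k) * qBinom_succ q n (k - 1)
      + q ^ k * ih k - qBinom_succ q n k - qBinom q n (k - 1) * e2

theorem qBinom_zero_right (q : ℂ) (n : ℕ) : qBinom q n 0 = 1 := by
  induction n with
  | zero => simp [qBinom_zero]
  | succ n ih => rw [qBinom_succ, ih, qBinom_of_neg q n (by norm_num)]; simp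

theorem qBinom_self (q : ℂ) (n : ℕ) : qBinom q n n = 1 := by
  induction n with
  | zero => simp [qBinom_zero]
  | succ n ih =>
    rw [qBinom_succ, qBinom_of_lt q n (k := ((n + 1 : ℕ) : ℤ)) (by push_cast; omega)]
    simpa using ih

theorem qBinom_add_mul (q : ℂ) (k l : ℕ) :
    qBinom q (k + l) k * (qPoch q q k * qPoch q q l) = qPoch q q (k + l) := by
  obtain ⟨n, hn⟩ : ∃ n, k + l = n := ⟨_, rfl⟩
  induction n generalizing k l with
  | zero =>
    obtain ⟨rfl, rfl⟩ : k = 0 ∧ l = 0 := by omega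
    simp [qBinom_zero, qPoch_zero]
  | succ n ih =>
    rcases k with _ | k
    · simp [qBinom_zero_right, qPoch_zero]
    rcases l with _ | l
    · rw [add_zero, qBinom_self, qPoch_zero, mul_one, one_mul]
    have h1 := ih k (l + 1) (by omega)
    have h2 := ih (k + 1) l (by omega)
    rw [show k + (l + 1) = k + l + 1 by ring] at h1
    rw [show k + 1 + l = k + l + 1 by ring] at h2
    rw [show k + 1 + (l + 1) = k + l + 1 + 1 by ring, qBinom_succ, qPoch_self_succ q (k + l + 1),
      qPoch_self_succ q k]
    rw [qPoch_self_succ q k] at h2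
    rw [show (((k + 1 : ℕ) : ℤ) - 1) = k by push_cast; ring, zpow_natCast]
    rw [qPoch_self_succ q l] at h1 ⊢
    have e : q ^ (k + l + 1 + 1) = q ^ (k + 1) * q ^ (l + 1) := by rw [← pow_add]; congr 1; ring
    rw [e]
    linear_combination (1 - q ^ (k + 1)) * h1 + q ^ (k + 1) * (1 - q ^ (l + 1)) * h2

theorem qBinom_add_eq {q : ℂ} (hq : ‖q‖ < 1) (k l : ℕ) :
    qBinom q (k + l) k = qPoch q q (k + l) * ((qPoch q q k)⁻¹ * (qPoch q q l)⁻¹) := by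
  have h1 := qPoch_self_ne_zero hq k
  have h2 := qPoch_self_ne_zero hq l
  rw [← qBinom_add_mul]
  field_simp

theorem qBinom_symm {q : ℂ} (hq : ‖q‖ < 1) (k l : ℕ) :
    qBinom q (k + l) k = qBinom q (k + l) l := by
  rw [qBinom_add_eq hq, add_comm k l, qBinom_add_eq hq]; ring

/-! ### Uniform bounds and limits. -/

theorem norm_qPoch_le (x : ℂ) {q : ℂ} (hq : ‖q‖ < 1) (n : ℕ) :
    ‖qPoch x q n‖ ≤ Real.exp (‖x‖ / (1 - ‖q‖)) := by
  have h1 : ‖qPoch x q n‖ ≤ Real.exp (∑ i ∈ Finset.range n, ‖x‖ * ‖q‖ ^ i) := by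
    rw [qPoch, norm_prod, Real.exp_sum]
    refine Finset.prod_le_prod (fun _ _ => norm_nonneg _) fun i _ => ?_
    calc ‖1 - x * q ^ i‖ ≤ ‖(1 : ℂ)‖ + ‖x * q ^ i‖ := norm_sub_le _ _
      _ = ‖x‖ * ‖q‖ ^ i + 1 := by rw [norm_one, norm_mul, norm_pow, add_comm]
      _ ≤ _ := Real.add_one_le_exp _
  refine h1.trans (Real.exp_le_exp.mpr ?_)
  rw [← Finset.mul_sum, div_eq_mul_inv, ← tsum_geometric_of_lt_one (norm_nonneg q) hq]
  exact mul_le_mul_of_nonneg_left ((summable_geometric_of_lt_one (norm_nonneg q) hq).sum_le_tsum _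
    fun i _ => pow_nonneg (norm_nonneg q) i) (norm_nonneg x)

theorem tendsto_qPoch (x : ℂ) {q : ℂ} (hq : ‖q‖ < 1) :
    Tendsto (qPoch x q) atTop (𝓝 (qPochInf x q)) :=
  (multipliable_qPochInf x hq).hasProd.tendsto_prod_nat

theorem qPochInf_self_ne_zero {q : ℂ} (hq : ‖q‖ < 1) : qPochInf q q ≠ 0 := by
  have h : ∏' i : ℕ, (1 + -(q * q ^ i)) ≠ 0 := by
    apply tprod_one_add_ne_zero_of_summable
    · intro i
      rw [← sub_eq_add_neg, ← pow_succ']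
      exact one_sub_pow_succ_ne_zero hq i
    · simp only [norm_neg, norm_mul, norm_pow]
      exact (summable_geometric_of_lt_one (norm_nonneg q) hq).mul_left _
  simpa [qPochInf, sub_eq_add_neg] using h

theorem exists_norm_inv_qPoch_le {q : ℂ} (hq : ‖q‖ < 1) :
    ∃ C : ℝ, 0 ≤ C ∧ ∀ n, ‖(qPoch q q n)⁻¹‖ ≤ C := by
  obtain ⟨C, hC⟩ := (Metric.isBounded_range_of_tendsto _
    ((tendsto_qPoch q hq).inv₀ (qPochInf_self_ne_zero hq))).exists_norm_le
  exact ⟨C, (norm_nonneg _).trans (hC _ ⟨0, rfl⟩), fun n => hC _ ⟨n, rfl⟩⟩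

/-- Uniformity in both indices is the point: it supplies the dominating constant when sums are
exchanged and when the parameter `N` of the diagonal sums varies. -/
theorem exists_norm_qBinom_le {q : ℂ} (hq : ‖q‖ < 1) :
    ∃ C : ℝ, 0 ≤ C ∧ ∀ n k, ‖qBinom q n k‖ ≤ C := by
  obtain ⟨C, hC0, hC⟩ := exists_norm_inv_qPoch_le hq
  have h0 : 0 ≤ Real.exp (‖q‖ / (1 - ‖q‖)) * (C * C) := by positivity
  refine ⟨_, h0, fun n k => ?_⟩
  rcases lt_or_ge k 0 with hk | hk
  · rw [qBinom_of_neg q n hk, norm_zero]; exact h0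
  rcases lt_or_ge (n : ℤ) k with hn | hn
  · rw [qBinom_of_lt q n hn, norm_zero]; exact h0
  obtain ⟨k, rfl⟩ := Int.eq_ofNat_of_zero_le hk
  obtain ⟨l, rfl⟩ := Nat.exists_eq_add_of_le (Int.ofNat_le.mp hn)
  rw [qBinom_add_eq hq, norm_mul, norm_mul]
  gcongr
  · exact norm_qPoch_le q hq _
  · exact hC k
  · exact hC l

theorem hasSum_of_eq {ι : Type*} {f g : ι → ℂ} {a b : ℂ} (h : HasSum f a) (hf : ∀ i, g i = f i)
    (ha : b = a) : HasSum g b := by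
  rw [funext hf, ha]; exact h

/-! ### The finite Jacobi triple product. -/

/-- The binomial coefficient `k (k - 1) / 2` of an integer. -/
def tri (k : ℤ) : ℤ := k * (k - 1) / 2

theorem two_mul_tri (k : ℤ) : 2 * tri k = k * (k - 1) :=
  Int.mul_ediv_cancel' (even_iff_two_dvd.mp (Int.even_mul_pred_self k))

theorem tri_add_one (k : ℤ) : tri (k + 1) = tri k + k := by
  linarith [two_mul_tri k, two_mul_tri (k + 1)]

theorem summable_zpow_mul_zpow_tri {a r : ℝ} (ha : 0 < a) (hr0 : 0 < r) (hr1 : r < 1) :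
    Summable fun k : ℤ => a ^ k * r ^ tri k := by
  -- Each half of the bilateral series has consecutive ratios `b r^(n+c)`, which tend to 0.
  have key : ∀ (b : ℝ) (c : ℕ) (u : ℕ → ℝ), (∀ n, 0 < u n) →
      (∀ n, u (n + 1) = u n * (b * r ^ (n + c))) → Summable u := by
    intro b c u hu hrec
    refine summable_of_ratio_test_tendsto_lt_one (l := 0) one_pos
      (Eventually.of_forall fun n => (hu n).ne') ?_
    have h1 : Tendsto (fun n : ℕ => b * r ^ (n + c)) atTop (𝓝 (b * 0)) :=
      ((tendsto_pow_atTop_nhds_zero_of_lt_one hr0.le hr1).comp (tendsto_add_atTop_nat c)).const_mul b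
    rw [mul_zero] at h1
    refine (h1.congr fun n => ?_)
    rw [Real.norm_of_nonneg (hu _).le, Real.norm_of_nonneg (hu _).le, hrec,
      mul_div_cancel_left₀ _ (hu n).ne']
  apply Summable.of_nat_of_neg_add_one
  · refine key a 0 _ (fun n => by positivity) fun n => ?_
    rw [Nat.cast_add_one, tri_add_one, zpow_add_one₀ ha.ne', zpow_add₀ hr0.ne', add_zero,
      zpow_natCast r n]
    ring
  · refine key a⁻¹ 2 _ (fun n => by positivity) fun n => ?_
    have e1 : tri (-(((n + 1 : ℕ) : ℤ) + 1)) = tri (-((n : ℤ) + 1)) + ((n + 2 : ℕ) : ℤ) := by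
      have h1 := two_mul_tri (-(((n + 1 : ℕ) : ℤ) + 1))
      have h2 := two_mul_tri (-((n : ℤ) + 1))
      push_cast at h1 ⊢
      linarith
    have e2 : -(((n + 1 : ℕ) : ℤ) + 1) = -((n : ℤ) + 1) + -1 := by push_cast; ring
    rw [e1, zpow_add₀ hr0.ne', zpow_natCast, e2, zpow_add₀ ha.ne', zpow_neg_one]
    ring

/-- The Laurent coefficients of the finite Jacobi triple product. -/
noncomputable def tripleTerm (x q : ℂ) (n : ℕ) (k : ℤ) : ℂ :=
  (-1) ^ k * x ^ k * q ^ tri k * qBinom q (2 * n) (n + k)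

theorem qBinom_two_mul_succ {q : ℂ} (hq : q ≠ 0) (n : ℕ) (i : ℤ) :
    qBinom q (2 * (n + 1)) (i + 1) = q ^ (2 * (n : ℤ) + 1 - i) * qBinom q (2 * n) (i - 1)
      + (1 + q ^ (2 * n + 1)) * qBinom q (2 * n) i + q ^ (i + 1) * qBinom q (2 * n) (i + 1) := by
  rw [show 2 * (n + 1) = 2 * n + 1 + 1 by ring, qBinom_succ, qBinom_succ' hq, qBinom_succ' hq,
    add_sub_cancel_right]
  have e : q ^ (i + 1) * q ^ (((2 * n : ℕ) : ℤ) + 1 - (i + 1)) = q ^ (2 * n + 1) := by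
    rw [← zpow_add₀ hq, ← zpow_natCast]; congr 1; push_cast; ring
  push_cast at e ⊢
  linear_combination qBinom q (2 * n) i * e

/-- The coefficients are those of `(1 - x q^n)(1 - q^(n+1)/x) = 1 + q^(2n+1) - x q^n - q^(n+1)/x`,
the factor by which the product grows from `n` to `n + 1`. -/
theorem tripleTerm_succ {x q : ℂ} (hx : x ≠ 0) (hq : q ≠ 0) (n : ℕ) (k : ℤ) :
    tripleTerm x q (n + 1) k = (1 + q ^ (2 * n + 1)) * tripleTerm x q n k
      - x * q ^ n * tripleTerm x q n (k - 1) - q ^ (n + 1) / x * tripleTerm x q n (k + 1) := by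
  have h1 : tri k = tri (k - 1) + (k - 1) := by simpa using tri_add_one (k - 1)
  have e1 : ((n + 1 : ℕ) : ℤ) + k = (n + k : ℤ) + 1 := by push_cast; ring
  have e2 : (n : ℤ) + (k - 1) = n + k - 1 := by ring
  have e3 : (n : ℤ) + (k + 1) = n + k + 1 := by ring
  unfold tripleTerm
  rw [e1, qBinom_two_mul_succ hq, e2, e3, tri_add_one, h1]
  have e4 : q ^ (2 * (n : ℤ) + 1 - (n + k)) = q ^ n * (q ^ (k - 1))⁻¹ := by
    rw [← zpow_natCast, ← zpow_neg, ← zpow_add₀ hq]; congr 1; ring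
  have e5 : q ^ ((n : ℤ) + k + 1) = q ^ (n + 1) * q ^ k := by
    rw [← zpow_natCast, ← zpow_add₀ hq]; congr 1; push_cast; ring
  rw [e4, e5, zpow_add₀ hq (tri (k - 1) + (k - 1)) k, zpow_add₀ hq (tri (k - 1)) (k - 1),
    zpow_add_one₀ hx, zpow_sub_one₀ hx, zpow_add_one₀ (by norm_num : (-1 : ℂ) ≠ 0),
    zpow_sub_one₀ (by norm_num : (-1 : ℂ) ≠ 0)]
  have := zpow_ne_zero (k - 1) hq
  field_simp
  ring

/-- The finite Jacobi triple product identity. -/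
theorem hasSum_tripleTerm {x q : ℂ} (hx : x ≠ 0) (hq : q ≠ 0) (n : ℕ) :
    HasSum (tripleTerm x q n) (qPoch x q n * qPoch (q / x) q n) := by
  induction n with
  | zero =>
    refine hasSum_of_eq (hasSum_ite_eq (0 : ℤ) (1 : ℂ)) (fun k => ?_) ?_
    · by_cases hk : k = 0
      · simp [tripleTerm, qBinom_zero, hk, tri]
      · simp [tripleTerm, qBinom_zero, hk]
    · simp [qPoch_zero]
  | succ n ih =>
    have h1 := (Equiv.subRight (1 : ℤ)).hasSum_iff.mpr ih
    have h2 := (Equiv.addRight (1 : ℤ)).hasSum_iff.mpr ih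
    have h := ((ih.mul_left (1 + q ^ (2 * n + 1))).sub (h1.mul_left (x * q ^ n))).sub
      (h2.mul_left (q ^ (n + 1) / x))
    refine hasSum_of_eq h (fun k => ?_) ?_
    · exact tripleTerm_succ hx hq n k
    · rw [qPoch_succ, qPoch_succ]
      field_simp
      ring

/-! ### Diagonal sums of Gaussian binomials and partial theta series. -/

/-- Applying the two Pascal rules in turn to `[2M+N+4, M+1]` leaves `[2M+N+2, M]` plus exactly the
two new summands. -/
theorem sum_qBinom_telescope {q : ℂ} (hq : q ≠ 0) (N M : ℕ) :
    ∑ m ∈ Finset.range (M + 1), q ^ m * qBinom q (2 * m + N) m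
      + q ^ (N + 3) * ∑ m ∈ Finset.range M, q ^ m * qBinom q (2 * m + (N + 3)) m
      = qBinom q (2 * M + N + 2) M := by
  induction M with
  | zero => simp [qBinom_zero_right]
  | succ M ih =>
    rw [Finset.sum_range_succ _ (M + 1),
      Finset.sum_range_succ (fun m : ℕ => q ^ m * qBinom q (2 * m + (N + 3)) m) M]
    have e1 := qBinom_succ' hq (2 * (M + 1) + N + 1) ((M + 1 : ℕ) : ℤ)
    have e2 := qBinom_succ q (2 * (M + 1) + N) ((M + 1 : ℕ) : ℤ)
    rw [show ((M + 1 : ℕ) : ℤ) - 1 = M by push_cast; ring] at e1 e2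
    rw [show (((2 * (M + 1) + N + 1 : ℕ) : ℤ) + 1 - ((M + 1 : ℕ) : ℤ)) = ((N + 3 + M : ℕ) : ℤ) by
      push_cast; ring, zpow_natCast] at e1
    rw [zpow_natCast] at e2
    rw [show 2 * (M + 1) + N + 1 = 2 * M + (N + 3) by ring] at e1 e2
    rw [show 2 * (M + 1) + N = 2 * M + N + 2 by ring] at e2 ⊢
    rw [show 2 * M + N + 2 + 2 = 2 * M + (N + 3) + 1 by ring, e1, e2, pow_add]
    linear_combination ih

theorem summable_qBinom_diag {q : ℂ} (hq1 : ‖q‖ < 1) (N : ℕ) :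
    Summable fun m : ℕ => q ^ m * qBinom q (2 * m + N) m := by
  obtain ⟨C, -, hC⟩ := exists_norm_qBinom_le hq1
  refine Summable.of_norm_bounded
    ((summable_geometric_of_lt_one (norm_nonneg q) hq1).mul_right C) fun m => ?_
  rw [norm_mul, norm_pow]
  exact mul_le_mul_of_nonneg_left (hC _ _) (by positivity)

/-- The sum `∑ q^m [2m + N, m]` over `m ≥ 0`. -/
noncomputable def diagSum (q : ℂ) (N : ℕ) : ℂ := ∑' m : ℕ, q ^ m * qBinom q (2 * m + N) m

theorem tendsto_qBinom_diag {q : ℂ} (hq1 : ‖q‖ < 1) (N : ℕ) :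
    Tendsto (fun M : ℕ => qBinom q (2 * M + N) M) atTop (𝓝 (qPochInf q q)⁻¹) := by
  have h := tendsto_qPoch q hq1
  have hne := qPochInf_self_ne_zero hq1
  have h1 : Tendsto (fun M : ℕ => M + (M + N)) atTop atTop :=
    tendsto_atTop_mono (fun M => Nat.le_add_right M _) tendsto_id
  have h2 : Tendsto (fun M : ℕ => M + N) atTop atTop := tendsto_add_atTop_nat N
  have := (h.comp h1).mul ((h.inv₀ hne).mul ((h.comp h2).inv₀ hne))
  rw [mul_inv_cancel_left₀ hne] at this
  refine this.congr fun M => ?_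
  rw [show 2 * M + N = M + (M + N) by ring, qBinom_add_eq hq1]
  rfl

theorem diagSum_add {q : ℂ} (hq : q ≠ 0) (hq1 : ‖q‖ < 1) (N : ℕ) :
    diagSum q N + q ^ (N + 3) * diagSum q (N + 3) = (qPochInf q q)⁻¹ := by
  have h1 := (summable_qBinom_diag hq1 N).hasSum.tendsto_sum_nat.comp (tendsto_add_atTop_nat 1)
  have h2 := (summable_qBinom_diag hq1 (N + 3)).hasSum.tendsto_sum_nat.const_mul (q ^ (N + 3))
  refine tendsto_nhds_unique (h1.add h2) ?_
  refine (tendsto_qBinom_diag hq1 (N + 2)).congr fun M => ?_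
  exact (sum_qBinom_telescope hq N M).symm

/-- The term of index `s` of the partial theta series `∑ (-1)^s q^{3 s (s + 1) / 2 + N s}`. -/
noncomputable def partialThetaTerm (q : ℂ) (N s : ℕ) : ℂ :=
  (-1) ^ s * q ^ (3 * tri (s + 1) + N * s)

theorem norm_partialThetaTerm_le {q : ℂ} (hq : q ≠ 0) (hq1 : ‖q‖ < 1) (N s : ℕ) :
    ‖partialThetaTerm q N s‖ ≤ ‖q‖ ^ s := by
  rw [partialThetaTerm, norm_mul, norm_pow, norm_neg, norm_one, one_pow, one_mul, norm_zpow,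
    ← zpow_natCast]
  refine zpow_le_zpow_right_of_le_one₀ (norm_pos_iff.mpr hq) hq1.le ?_
  have h := two_mul_tri (s + 1)
  have h1 : (0 : ℤ) ≤ N * s := by positivity
  have h2 : (0 : ℤ) ≤ s * s := by positivity
  have h3 : (0 : ℤ) ≤ s := by positivity
  nlinarith

theorem summable_partialThetaTerm {q : ℂ} (hq : q ≠ 0) (hq1 : ‖q‖ < 1) (N : ℕ) :
    Summable (partialThetaTerm q N) :=
  Summable.of_norm_bounded (summable_geometric_of_lt_one (norm_nonneg q) hq1)
    (norm_partialThetaTerm_le hq hq1 N)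

theorem tsum_partialThetaTerm {q : ℂ} (hq : q ≠ 0) (hq1 : ‖q‖ < 1) (N : ℕ) :
    ∑' s, partialThetaTerm q N s = 1 - q ^ (N + 3) * ∑' s, partialThetaTerm q (N + 3) s := by
  rw [(summable_partialThetaTerm hq hq1 N).tsum_eq_zero_add, ← tsum_mul_left, sub_eq_add_neg,
    ← tsum_neg]
  congr 1
  · simp [partialThetaTerm, tri]
  · refine tsum_congr fun s => ?_
    have e : 3 * tri (((s + 1 : ℕ) : ℤ) + 1) + N * ((s + 1 : ℕ) : ℤ)
        = ((N + 3 : ℕ) : ℤ) + (3 * tri (s + 1) + ((N + 3 : ℕ) : ℤ) * s) := by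
      rw [tri_add_one]; push_cast; ring
    rw [partialThetaTerm, partialThetaTerm, e, zpow_add₀ hq, zpow_natCast, pow_succ]
    ring

/-- Both sides satisfy `y(N) = 1 - q^(N+3) y(N+3)`. Their difference `D` is bounded uniformly in
`N`, and each use of the homogeneous recursion gains a factor at most `‖q‖`, so `D = 0`. -/
theorem qPochInf_mul_diagSum {q : ℂ} (hq : q ≠ 0) (hq1 : ‖q‖ < 1) (N : ℕ) :
    qPochInf q q * diagSum q N = ∑' s, partialThetaTerm q N s := by
  set D : ℕ → ℂ := fun N => qPochInf q q * diagSum q N - ∑' s, partialThetaTerm q N s with hD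
  have hrec : ∀ N, D N = -q ^ (N + 3) * D (N + 3) := by
    intro N
    have h1 := diagSum_add hq hq1 N
    have h2 := tsum_partialThetaTerm hq hq1 N
    have h3 := mul_inv_cancel₀ (qPochInf_self_ne_zero hq1)
    simp only [hD]
    linear_combination qPochInf q q * h1 - h2 + h3
  obtain ⟨C, hC0, hC⟩ := exists_norm_qBinom_le hq1
  have hgeo := summable_geometric_of_lt_one (norm_nonneg q) hq1
  have hbd : ∃ B, ∀ N, ‖D N‖ ≤ B := by
    refine ⟨‖qPochInf q q‖ * ∑' m : ℕ, ‖q‖ ^ m * C + ∑' m : ℕ, ‖q‖ ^ m, fun N => ?_⟩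
    refine (norm_sub_le _ _).trans (add_le_add ?_ ?_)
    · rw [norm_mul]
      refine mul_le_mul_of_nonneg_left ?_ (norm_nonneg _)
      refine tsum_of_norm_bounded (hgeo.mul_right C).hasSum fun m => ?_
      rw [norm_mul, norm_pow]
      exact mul_le_mul_of_nonneg_left (hC _ _) (by positivity)
    · exact tsum_of_norm_bounded hgeo.hasSum (norm_partialThetaTerm_le hq hq1 N)
  obtain ⟨B, hB⟩ := hbd
  have hpow : ∀ k N, ‖D N‖ ≤ ‖q‖ ^ k * B := by
    intro k
    induction k with
    | zero => simpa using hB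
    | succ k ih =>
      intro N
      rw [hrec, norm_mul, norm_neg, norm_pow]
      calc ‖q‖ ^ (N + 3) * ‖D (N + 3)‖ ≤ ‖q‖ ^ 1 * (‖q‖ ^ k * B) := by
            gcongr ?_ * ?_
            · exact pow_le_pow_of_le_one (norm_nonneg q) hq1.le (by omega)
            · exact ih _
        _ = _ := by ring
  have hlim : Tendsto (fun k : ℕ => ‖q‖ ^ k * B) atTop (𝓝 (0 * B)) :=
    (tendsto_pow_atTop_nhds_zero_of_lt_one (norm_nonneg q) hq1).mul_const B
  rw [zero_mul] at hlim
  have : ‖D N‖ ≤ 0 := ge_of_tendsto' hlim fun k => hpow k N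
  exact sub_eq_zero.mp (norm_le_zero_iff.mp this)

/-- The terms with `n < |k|` vanish. Putting `n = m + |k|`, and using symmetry of the binomial when
`k ≥ 0`, leaves a diagonal sum. -/
theorem hasSum_qBinom_central {q : ℂ} (hq1 : ‖q‖ < 1) (k : ℤ) :
    HasSum (fun n : ℕ => q ^ n * qBinom q (2 * n) (n + k))
      (q ^ k.natAbs * diagSum q (2 * k.natAbs)) := by
  set ρ := k.natAbs with hρ
  have h := (summable_qBinom_diag hq1 (2 * ρ)).hasSum.mul_left (q ^ ρ)
  have h0 : ∑ i ∈ Finset.range ρ, q ^ i * qBinom q (2 * i) (i + k) = 0 := by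
    refine Finset.sum_eq_zero fun i hi => ?_
    have hi := Finset.mem_range.mp hi
    rcases le_or_gt 0 k with hk | hk
    · rw [qBinom_of_lt q _ (by push_cast; omega), mul_zero]
    · rw [qBinom_of_neg q _ (by omega), mul_zero]
  have := (hasSum_nat_add_iff (f := fun n : ℕ => q ^ n * qBinom q (2 * n) (n + k))
    (g := q ^ ρ * diagSum q (2 * ρ)) ρ).mp ?_
  · rwa [h0, add_zero] at this
  · refine hasSum_of_eq h (fun m => ?_) rfl
    rw [← mul_assoc, ← pow_add, add_comm ρ m]
    congr 1
    rcases le_or_gt 0 k with hk | hk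
    · have e : ((m + ρ : ℕ) : ℤ) + k = ((m + 2 * ρ : ℕ) : ℤ) := by push_cast; omega
      rw [e, show 2 * (m + ρ) = m + (m + 2 * ρ) by ring, ← qBinom_symm hq1,
        show m + (m + 2 * ρ) = 2 * m + 2 * ρ by ring]
    · have e : ((m + ρ : ℕ) : ℤ) + k = (m : ℤ) := by push_cast; omega
      rw [e, show 2 * (m + ρ) = 2 * m + 2 * ρ by ring]

/-! ### The Hecke-type double sum and its rows. -/

theorem sg₂_of_nonneg {r s : ℤ} (hr : 0 ≤ r) (hs : 0 ≤ s) : sg₂ r s = 1 := by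
  simp [sg₂, sg, hr, hs]

theorem sg₂_of_neg {r s : ℤ} (hr : r < 0) (hs : s < 0) : sg₂ r s = -1 := by
  simp [sg₂, sg, not_le.mpr hr, not_le.mpr hs]

theorem sg₂_of_nonneg_of_neg {r s : ℤ} (hr : 0 ≤ r) (hs : s < 0) : sg₂ r s = 0 := by
  simp [sg₂, sg, hr, not_le.mpr hs]

theorem sg₂_of_neg_of_nonneg {r s : ℤ} (hr : r < 0) (hs : 0 ≤ s) : sg₂ r s = 0 := by
  simp [sg₂, sg, hs, not_le.mpr hr]

theorem norm_sg₂_le (r s : ℤ) : ‖sg₂ r s‖ ≤ 1 := by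
  rcases le_or_gt 0 r with hr | hr <;> rcases le_or_gt 0 s with hs | hs
  · simp [sg₂_of_nonneg hr hs]
  · simp [sg₂_of_nonneg_of_neg hr hs]
  · simp [sg₂_of_neg_of_nonneg hr hs]
  · simp [sg₂_of_neg hr hs]

theorem summable_heckeTerm {q x : ℂ} (hq : q ≠ 0) (hq1 : ‖q‖ < 1) (hx : x ≠ 0) :
    Summable (heckeTerm 1 2 3 (x⁻¹ * q ^ 2) (q ^ 3) q) := by
  have hq' : 0 < ‖q‖ := norm_pos_iff.mpr hq
  have hx' : 0 < ‖x‖ := norm_pos_iff.mpr hx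
  have h3 : ‖q‖ ^ 3 < 1 := pow_lt_one₀ hq'.le hq1 (by norm_num)
  have hs := (summable_zpow_mul_zpow_tri (a := ‖x⁻¹ * q ^ 2‖) (by
    rw [norm_mul, norm_inv, norm_pow]; positivity) hq' hq1).mul_of_nonneg
    (summable_zpow_mul_zpow_tri (a := ‖q‖ ^ 3) (by positivity) (by positivity) h3)
    (fun k => by positivity) (fun k => by positivity)
  refine Summable.of_norm_bounded hs fun ⟨r, s⟩ => ?_
  -- The sign factor kills `r s < 0`, the only region where the indefinite cross term could grow;
  -- what remains is a product of two convergent theta series.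
  have hsg : ‖sg₂ r s‖ * ‖q‖ ^ (2 * r * s) ≤ 1 := by
    rcases le_or_gt 0 (r * s) with h | h
    · calc ‖sg₂ r s‖ * ‖q‖ ^ (2 * r * s) ≤ 1 * 1 := by
            gcongr
            · exact norm_sg₂_le r s
            · exact zpow_le_one₀ hq' hq1.le (by linarith)
        _ = 1 := one_mul 1
    · have : sg₂ r s = 0 := by
        rcases mul_neg_iff.mp h with ⟨hr, hs⟩ | ⟨hr, hs⟩
        · exact sg₂_of_nonneg_of_neg hr.le hs
        · exact sg₂_of_neg_of_nonneg hr hs.le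
      simp [this]
  have e : q ^ (1 * (r * (r - 1) / 2) + 2 * r * s + 3 * (s * (s - 1) / 2))
      = q ^ tri r * q ^ (2 * r * s) * (q ^ 3) ^ tri s := by
    rw [zpow_add₀ hq, zpow_add₀ hq, one_mul, zpow_mul q 3]; rfl
  simp only [heckeTerm]
  rw [e]
  simp only [norm_mul, norm_zpow, norm_neg, norm_one, one_zpow, norm_pow]
  calc _ = (‖sg₂ r s‖ * ‖q‖ ^ (2 * r * s)) *
        ((‖x⁻¹‖ * ‖q‖ ^ 2) ^ r * ‖q‖ ^ tri r * ((‖q‖ ^ 3) ^ s * (‖q‖ ^ 3) ^ tri s)) := by ring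
    _ ≤ _ := mul_le_of_le_one_left (by positivity) hsg

/-- The signs restrict row `r` to the half-line `s ≥ 0` or `s < 0` according to the sign of `r`; the
substitution `s ↦ -(s+1)` brings the second case to the first. The value is written in `-r` because
row `r` carries `x^(-r)`. -/
theorem hasSum_heckeTerm_right {q x : ℂ} (hq : q ≠ 0) (hq1 : ‖q‖ < 1) (r : ℤ) :
    HasSum (fun s => heckeTerm 1 2 3 (x⁻¹ * q ^ 2) (q ^ 3) q (r, s))
      ((-1) ^ (-r) * x ^ (-r) * q ^ tri (-r) *
        (q ^ (-r).natAbs * ∑' s, partialThetaTerm q (2 * (-r).natAbs) s)) := by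
  have h := ((summable_partialThetaTerm hq hq1 (2 * (-r).natAbs)).hasSum.mul_left
    (q ^ (-r).natAbs)).mul_left ((-1) ^ (-r) * x ^ (-r) * q ^ tri (-r))
  have hm : ((-1 : ℂ)) ≠ 0 := by norm_num
  have ht := two_mul_tri (-r)
  have ht' := two_mul_tri r
  have hneg : ((-1 : ℂ)) ^ (-r) = (-1) ^ r := by
    rw [zpow_neg, ← inv_zpow]; norm_num
  have hq3 : ∀ s : ℤ, (q ^ 3) ^ s = q ^ (3 * s) := fun s => by
    rw [zpow_mul]; rfl
  have hq2 : (q ^ 2) ^ r = q ^ (2 * r) := by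
    rw [zpow_mul]; rfl
  have key : ∀ s : ℤ, heckeTerm 1 2 3 (x⁻¹ * q ^ 2) (q ^ 3) q (r, s) = sg₂ r s *
      ((-1) ^ r * (-1) ^ s * x ^ (-r) * q ^ (2 * r + 3 * s + (tri r + 2 * r * s + 3 * tri s))) := by
    intro s
    simp only [heckeTerm]
    rw [zpow_add₀ hm, mul_zpow, inv_zpow', hq3, hq2, zpow_add₀ hq (2 * r + 3 * s),
      zpow_add₀ hq (2 * r), one_mul]
    simp only [tri]
    ring
  rcases le_or_gt 0 r with hr | hr
  · have hinj : Function.Injective (fun n : ℕ => (n : ℤ)) := Nat.cast_injective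
    rw [← hinj.hasSum_iff]
    · refine hasSum_of_eq h (fun s => ?_) rfl
      have hρ : ((-r).natAbs : ℤ) = r := by omega
      rw [Function.comp_apply, key, sg₂_of_nonneg hr (by positivity), partialThetaTerm, hneg,
        ← zpow_natCast q, ← zpow_natCast (-1 : ℂ) s]
      rw [Nat.cast_mul, hρ, Nat.cast_ofNat]
      have e : 2 * r + 3 * (s : ℤ) + (tri r + 2 * r * s + 3 * tri s)
          = tri (-r) + (r + (3 * tri (s + 1) + 2 * r * s)) := by
        rw [tri_add_one]; linarith
      rw [e, zpow_add₀ hq, zpow_add₀ hq]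
      ring
    · intro s hs
      have : s < 0 := by
        by_contra h0
        exact hs ⟨s.toNat, by simp; omega⟩
      rw [key, sg₂_of_nonneg_of_neg hr this, zero_mul]
  · have hinj : Function.Injective (fun n : ℕ => -((n : ℤ) + 1)) := fun a b hab => by
      simp only at hab; omega
    rw [← hinj.hasSum_iff]
    · refine hasSum_of_eq h (fun s => ?_) rfl
      have hρ : ((-r).natAbs : ℤ) = -r := by omega
      rw [Function.comp_apply, key, sg₂_of_neg hr (by omega), partialThetaTerm, hneg,
        ← zpow_natCast q]
      rw [Nat.cast_mul, hρ, Nat.cast_ofNat]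
      have e : 2 * r + 3 * (-((s : ℤ) + 1)) + (tri r + 2 * r * (-((s : ℤ) + 1)) + 3 * tri (-((s : ℤ) + 1)))
          = tri (-r) + (-r + (3 * tri (s + 1) + 2 * -r * s)) := by
        have h1 := two_mul_tri (-((s : ℤ) + 1))
        have h2 := two_mul_tri ((s : ℤ) + 1)
        linarith
      have e' : (-1 : ℂ) ^ (-((s : ℤ) + 1)) = - (-1) ^ s := by
        rw [zpow_neg, ← inv_zpow, zpow_add_one₀ (by norm_num)]; norm_num
      rw [e, e', zpow_add₀ hq, zpow_add₀ hq]
      ring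
    · intro s hs
      have : 0 ≤ s := by
        by_contra h0
        exact hs ⟨(-s - 1).toNat, by simp only; omega⟩
      rw [key, sg₂_of_neg_of_nonneg hr this, zero_mul]

/-! ### The series `𝒰` and its Hecke form. -/

theorem chains_one (n : ℕ) : chains 1 n = {fun _ => n} := by
  ext ν
  simp only [chains, Finset.mem_filter, Fintype.mem_piFinset, Finset.mem_range,
    Finset.mem_singleton]
  constructor
  · rintro ⟨-, -, h⟩
    funext i
    exact h i (by omega)
  · rintro rfl
    exact ⟨fun _ => n.lt_succ_self, fun _ _ _ => le_rfl, fun _ _ => rfl⟩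

theorem UTerm_one (x q : ℂ) (n : ℕ) :
    UTerm 1 1 (-x) q n = q ^ n * (qPoch x q n * qPoch (q / x) q n) := by
  have hH : H n 1 1 0 q = 1 := by
    rw [H, chains_one, Finset.sum_singleton]
    rfl
  rw [UTerm, hH, neg_neg, neg_div_neg_eq]
  ring

theorem norm_UTerm_one_le (x : ℂ) {q : ℂ} (hq1 : ‖q‖ < 1) (n : ℕ) :
    ‖UTerm 1 1 (-x) q n‖ ≤ ‖q‖ ^ n *
      (Real.exp (‖x‖ / (1 - ‖q‖)) * Real.exp (‖q / x‖ / (1 - ‖q‖))) := by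
  rw [UTerm_one, norm_mul, norm_mul, norm_pow]
  gcongr
  · exact norm_qPoch_le x hq1 n
  · exact norm_qPoch_le (q / x) hq1 n

theorem summable_UTerm_one (x : ℂ) {q : ℂ} (hq1 : ‖q‖ < 1) : Summable (UTerm 1 1 (-x) q) :=
  Summable.of_norm_bounded ((summable_geometric_of_lt_one (norm_nonneg q) hq1).mul_right _)
    (norm_UTerm_one_le x hq1)

theorem U_eq_hecke {q x : ℂ} (hq : q ≠ 0) (hq1 : ‖q‖ < 1) (hx : x ≠ 0) :
    U 1 1 (-x) q = 1 / qPochInf q q * hecke 1 2 3 (x⁻¹ * q ^ 2) (q ^ 3) q := by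
  have hq' : 0 < ‖q‖ := norm_pos_iff.mpr hq
  have hx' : 0 < ‖x‖ := norm_pos_iff.mpr hx
  obtain ⟨C, hC0, hC⟩ := exists_norm_qBinom_le hq1
  have hsum : Summable (Function.uncurry fun (n : ℕ) (k : ℤ) => q ^ n * tripleTerm x q n k) := by
    have hs := ((summable_geometric_of_lt_one (norm_nonneg q) hq1).mul_of_nonneg
      (summable_zpow_mul_zpow_tri hx' hq' hq1) (fun k => by positivity)
      (fun k => by positivity)).mul_right C
    refine Summable.of_norm_bounded hs fun ⟨n, k⟩ => ?_
    simp only [Function.uncurry, tripleTerm, norm_mul, norm_zpow, norm_pow, norm_neg, norm_one,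
      one_zpow, one_mul]
    rw [mul_assoc (‖q‖ ^ n)]
    gcongr
    exact hC _ _
  have hne := qPochInf_self_ne_zero hq1
  have h1 : U 1 1 (-x) q = ∑' (n : ℕ) (k : ℤ), q ^ n * tripleTerm x q n k :=
    tsum_congr fun n => by
      rw [UTerm_one]; exact ((hasSum_tripleTerm hx hq n).mul_left _).tsum_eq.symm
  have h2 : ∀ k : ℤ, ∑' n : ℕ, q ^ n * tripleTerm x q n k = (-1) ^ k * x ^ k * q ^ tri k *
      (q ^ k.natAbs * diagSum q (2 * k.natAbs)) := fun k => by
    rw [← (hasSum_qBinom_central hq1 k).tsum_eq, ← tsum_mul_left]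
    exact tsum_congr fun n => by rw [tripleTerm]; ring
  rw [h1, ← hsum.tsum_comm, hecke, (summable_heckeTerm hq hq1 hx).tsum_prod,
    ← (Equiv.neg ℤ).tsum_eq, ← tsum_mul_left]
  refine tsum_congr fun r => ?_
  rw [(hasSum_heckeTerm_right hq hq1 r).tsum_eq, Equiv.neg_apply, h2, ← qPochInf_mul_diagSum hq hq1]
  field_simp

/-! ### The Bailey pair relative to `q` with `β_n = 1`. -/

theorem pow_choose_two_succ (q : ℂ) (k : ℕ) :
    q ^ (k + 1).choose 2 = q ^ k * q ^ k.choose 2 := by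
  rw [Nat.choose_succ_succ' k 1, Nat.choose_one_right, pow_add]

/-- The terms of the sum inverting the Bailey pair relative to `q` with `β_n = 1`. -/
noncomputable def inverseTerm (q : ℂ) (n k : ℕ) : ℂ :=
  (-1) ^ k * q ^ k.choose 2 * qPoch q q (2 * n - k) / qPoch q q k

/-- The sum inverting the Bailey pair relative to `q` with `β_n = 1`. -/
noncomputable def inverseSum (q : ℂ) (n : ℕ) : ℂ :=
  ∑ k ∈ Finset.range (n + 1), inverseTerm q n k

/-- Creative telescoping: the right side is the certificate for a first-order recursion of
`inverseSum` in `n`. The two ranges are offset by one so that `K = n + 1` completes both sums at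
once. -/
theorem inverseTerm_telescope {q : ℂ} (hq1 : ‖q‖ < 1) (n : ℕ) {K : ℕ} (hK : K ≤ n + 1) :
    ∑ k ∈ Finset.range (K + 1), inverseTerm q (n + 1) k
      - q ^ (4 * n + 3) * ∑ k ∈ Finset.range K, inverseTerm q n k
      = (1 - q ^ (2 * n + 2)) * q ^ K * (-1) ^ K * q ^ K.choose 2 * qPoch q q (2 * n + 1 - K)
        / qPoch q q K := by
  induction K with
  | zero =>
    rw [Finset.sum_range_one, Finset.sum_range_zero, inverseTerm, Nat.sub_zero, Nat.sub_zero,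
      mul_add, mul_one, qPoch_self_succ q (2 * n + 1)]
    simp [qPoch_zero]
    ring
  | succ K ih =>
    obtain ⟨d, hd⟩ : ∃ d, 2 * n = K + d := Nat.exists_eq_add_of_le (by omega)
    have ih := ih (by omega)
    rw [Finset.sum_range_succ _ (K + 1), Finset.sum_range_succ (inverseTerm q n) K]
    have h : ∀ a b c d e : ℂ, a + b - c * (d + e) = (a - c * d) + (b - c * e) := fun _ _ _ _ _ => by
      ring
    rw [h, ih, inverseTerm, inverseTerm]
    rw [show 2 * (n + 1) - (K + 1) = d + 1 by omega, show 2 * n - K = d by omega,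
      show 2 * n + 1 - K = d + 1 by omega, show 2 * n + 1 - (K + 1) = d by omega,
      show 4 * n + 3 = 2 * K + 2 * d + 3 by omega, show 2 * n + 2 = K + d + 2 by omega,
      qPoch_self_succ q d, qPoch_self_succ q K, pow_choose_two_succ]
    have h1 := qPoch_self_ne_zero hq1 K
    have h2 := one_sub_pow_succ_ne_zero hq1 K
    field_simp
    ring

theorem inverseSum_succ {q : ℂ} (hq1 : ‖q‖ < 1) (n : ℕ) :
    inverseSum q (n + 1) = q ^ (4 * n + 3) * inverseSum q n
      + (-1) ^ (n + 1) * (1 + q ^ (n + 1)) * q ^ (n + 1 + (n + 1).choose 2) := by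
  have h := inverseTerm_telescope hq1 n (K := n + 1) le_rfl
  rw [sub_eq_iff_eq_add'] at h
  rw [inverseSum, h, inverseSum, show 2 * n + 1 - (n + 1) = n by omega, qPoch_self_succ]
  have h1 := qPoch_self_ne_zero hq1 n
  have h2 := one_sub_pow_succ_ne_zero hq1 n
  rw [show q ^ (2 * n + 2) = q ^ (n + 1) * q ^ (n + 1) by rw [← pow_add]; congr 1; ring, pow_add]
  field_simp
  ring

/-- The truncated theta series `∑_{|j| ≤ n} (-1)^j q^{-j (3 j - 1) / 2}`. -/
noncomputable def truncTheta (q : ℂ) (n : ℕ) : ℂ :=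
  ∑ j ∈ Finset.Icc (-(n : ℤ)) n, (-1) ^ j * q ^ (-(tri j + j ^ 2))

theorem truncTheta_succ (q : ℂ) (n : ℕ) :
    truncTheta q (n + 1) = truncTheta q n
      + (-1) ^ (n + 1) * (q ^ (-(tri ((n : ℤ) + 1) + ((n : ℤ) + 1) ^ 2))
        + q ^ (-(tri (-((n : ℤ) + 1)) + ((n : ℤ) + 1) ^ 2))) := by
  have h : Finset.Icc (-((n + 1 : ℕ) : ℤ)) ((n + 1 : ℕ) : ℤ) =
      insert ((n : ℤ) + 1) (insert (-((n : ℤ) + 1)) (Finset.Icc (-(n : ℤ)) n)) := by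
    ext j
    simp only [Finset.mem_insert, Finset.mem_Icc]
    push_cast
    omega
  have e : (-1 : ℂ) ^ (-((n : ℤ) + 1)) = (-1) ^ (n + 1) := by
    rw [zpow_neg, ← inv_zpow, inv_neg_one]; exact_mod_cast rfl
  have e' : (-1 : ℂ) ^ ((n : ℤ) + 1) = (-1) ^ (n + 1) := by exact_mod_cast rfl
  rw [truncTheta, h, Finset.sum_insert, Finset.sum_insert, e, e', neg_sq, truncTheta]
  · ring
  · simp
  · simp only [Finset.mem_insert, Finset.mem_Icc]
    omega

theorem choose_two_eq_tri (n : ℕ) : ((n.choose 2 : ℕ) : ℤ) = tri n := by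
  induction n with
  | zero => simp [tri]
  | succ n ih =>
    rw [Nat.choose_succ_succ' n 1, Nat.choose_one_right]
    push_cast
    rw [ih, tri_add_one]
    ring

/-- The inhomogeneous term of the recursion for `inverseSum` is the contribution of the two new
indices `j = ±(n+1)` of the truncated theta series. -/
theorem inverseSum_eq {q : ℂ} (hq : q ≠ 0) (hq1 : ‖q‖ < 1) (n : ℕ) :
    inverseSum q n = q ^ (2 * n ^ 2 + n) * truncTheta q n := by
  induction n with
  | zero => simp [inverseSum, inverseTerm, truncTheta, tri, qPoch_zero]
  | succ n ih =>
    rw [inverseSum_succ hq1, ih, truncTheta_succ]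
    have h1 : q ^ (2 * (n + 1) ^ 2 + (n + 1)) * q ^ (-(tri ((n : ℤ) + 1) + ((n : ℤ) + 1) ^ 2))
        = q ^ (n + 1) * q ^ (n + 1 + (n + 1).choose 2) := by
      rw [← pow_add, ← zpow_natCast, ← zpow_natCast, ← zpow_add₀ hq]
      congr 1
      push_cast
      rw [choose_two_eq_tri]
      push_cast
      linarith [two_mul_tri ((n : ℤ) + 1)]
    have h2 : q ^ (2 * (n + 1) ^ 2 + (n + 1)) * q ^ (-(tri (-((n : ℤ) + 1)) + ((n : ℤ) + 1) ^ 2))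
        = q ^ (n + 1 + (n + 1).choose 2) := by
      rw [← zpow_natCast, ← zpow_natCast, ← zpow_add₀ hq]
      congr 1
      push_cast
      rw [choose_two_eq_tri]
      push_cast
      linarith [two_mul_tri ((n : ℤ) + 1), two_mul_tri (-((n : ℤ) + 1))]
    have h3 : q ^ (2 * (n + 1) ^ 2 + (n + 1)) = q ^ (4 * n + 3) * q ^ (2 * n ^ 2 + n) := by
      rw [← pow_add]; congr 1; ring
    rw [h3] at h1 h2 ⊢
    linear_combination -(-1) ^ (n + 1) * (h1 + h2)

/-- The terms of the orthogonality relation behind Bailey inversion relative to `q`. -/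
noncomputable def baileyTerm (q : ℂ) (a l k : ℕ) : ℂ :=
  (1 - q ^ (a + 2 * k + 1)) * (-1) ^ k * q ^ k.choose 2 * qPoch q q (a + k) /
    (qPoch q q k * qPoch q q (l - k) * qPoch q q (a + l + k + 1))

/-- The orthogonality sum is indefinitely summable; at `K = l` the closed form cancels the one
remaining term. -/
theorem sum_baileyTerm {q : ℂ} (hq1 : ‖q‖ < 1) (a : ℕ) {l K : ℕ} (hl : l ≠ 0) (hK : K ≤ l) :
    ∑ k ∈ Finset.range K, baileyTerm q a l k =
      -((-1) ^ K * q ^ K.choose 2 * qPoch q q (a + K) * (1 - q ^ K) /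
        (qPoch q q K * qPoch q q (l - K) * qPoch q q (a + l + K) * (1 - q ^ l))) := by
  induction K with
  | zero => simp
  | succ K ih =>
    obtain ⟨d, rfl⟩ : ∃ d, l = K + d + 1 := ⟨l - K - 1, by omega⟩
    rw [Finset.sum_range_succ, ih (by omega), baileyTerm,
      show K + d + 1 - K = d + 1 by omega, show K + d + 1 - (K + 1) = d by omega,
      show a + (K + d + 1) + (K + 1) = a + (K + d + 1) + K + 1 by ring,
      show a + (K + 1) = a + K + 1 by ring, qPoch_self_succ q (a + (K + d + 1) + K),
      qPoch_self_succ q d, qPoch_self_succ q K, qPoch_self_succ q (a + K), pow_choose_two_succ]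
    have h1 := qPoch_self_ne_zero hq1 K
    have h2 := one_sub_pow_succ_ne_zero hq1 K
    have h3 := qPoch_self_ne_zero hq1 d
    have h4 := one_sub_pow_succ_ne_zero hq1 d
    have h5 := qPoch_self_ne_zero hq1 (a + (K + d + 1) + K)
    have h6 := one_sub_pow_succ_ne_zero hq1 (a + (K + d + 1) + K)
    have h7 := one_sub_pow_succ_ne_zero hq1 (K + d)
    field_simp
    ring

theorem sum_baileyTerm_eq_zero {q : ℂ} (hq1 : ‖q‖ < 1) (a : ℕ) {l : ℕ} (hl : l ≠ 0) :
    ∑ k ∈ Finset.range (l + 1), baileyTerm q a l k = 0 := by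
  rw [Finset.sum_range_succ, sum_baileyTerm hq1 a hl le_rfl, baileyTerm, Nat.sub_self,
    show a + 2 * l + 1 = a + l + l + 1 by ring, qPoch_self_succ q (a + l + l)]
  have h1 := qPoch_self_ne_zero hq1 l
  have h2 := one_sub_pow_ne_zero hq1 hl
  have h5 := qPoch_self_ne_zero hq1 (a + l + l)
  have h6 := one_sub_pow_succ_ne_zero hq1 (a + l + l)
  have h0 : qPoch q q 0 ≠ 0 := qPoch_self_ne_zero hq1 0
  field_simp
  ring

/-- `(1 - q) α_n` for the Bailey pair relative to `q` with `β_n = 1`. -/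
noncomputable def alpha (q : ℂ) (n : ℕ) : ℂ :=
  q ^ (2 * n ^ 2 + n) * (1 - q ^ (2 * n + 1)) * truncTheta q n

/-- Bailey inversion: writing `α_r` through `inverseSum` with index `k = r - j` and exchanging the
sums, the inner sum is the orthogonality relation with `a = 2j`, `l = n - j`, so only `j = n`
survives. -/
theorem sum_alpha {q : ℂ} (hq : q ≠ 0) (hq1 : ‖q‖ < 1) (n : ℕ) :
    ∑ r ∈ Finset.range (n + 1),
      alpha q r * ((qPoch q q (n - r))⁻¹ * (qPoch q q (n + r + 1))⁻¹) = 1 := by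
  have h1 : ∀ r ∈ Finset.range (n + 1),
      alpha q r * ((qPoch q q (n - r))⁻¹ * (qPoch q q (n + r + 1))⁻¹) =
      ∑ j ∈ Finset.range (r + 1), (1 - q ^ (2 * r + 1)) * inverseTerm q r (r - j) *
        ((qPoch q q (n - r))⁻¹ * (qPoch q q (n + r + 1))⁻¹) := by
    intro r _
    rw [← Finset.sum_mul, ← Finset.mul_sum, Finset.sum_flip (inverseTerm q r), alpha,
      ← inverseSum, inverseSum_eq hq hq1]
    ring
  rw [Finset.sum_congr rfl h1, Finset.sum_comm' (t' := Finset.range (n + 1))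
    (s' := fun j => Finset.Ico j (n + 1))
    (fun r j => by simp only [Finset.mem_range, Finset.mem_Ico]; omega)]
  have h2 : ∀ j ∈ Finset.range (n + 1),
      ∑ r ∈ Finset.Ico j (n + 1), (1 - q ^ (2 * r + 1)) * inverseTerm q r (r - j) *
        ((qPoch q q (n - r))⁻¹ * (qPoch q q (n + r + 1))⁻¹) =
      ∑ k ∈ Finset.range (n - j + 1), baileyTerm q (2 * j) (n - j) k := by
    intro j hj
    have hj := Finset.mem_range.mp hj
    rw [Finset.sum_Ico_eq_sum_range, show n + 1 - j = n - j + 1 by omega]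
    refine Finset.sum_congr rfl fun k hk => ?_
    have hk := Finset.mem_range.mp hk
    rw [inverseTerm, baileyTerm, show j + k - j = k by omega,
      show 2 * (j + k) - k = 2 * j + k by omega, show n - j - k = n - (j + k) by omega,
      show 2 * j + (n - j) + k + 1 = n + (j + k) + 1 by omega,
      show 2 * (j + k) + 1 = 2 * j + 2 * k + 1 by ring]
    simp only [div_eq_mul_inv, mul_inv]
    ring
  rw [Finset.sum_congr rfl h2, Finset.sum_range_succ, Finset.sum_eq_zero, zero_add]
  · rw [Nat.sub_self, zero_add, Finset.sum_range_one, baileyTerm]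
    have h3 := qPoch_self_ne_zero hq1 (2 * n)
    have h4 := one_sub_pow_succ_ne_zero hq1 (2 * n)
    rw [Nat.sub_zero, add_zero, add_zero, mul_zero, add_zero, qPoch_self_succ]
    simp only [qPoch_zero, pow_zero, Nat.choose_zero_succ, mul_one, one_mul]
    field_simp
  · intro j hj
    have hj := Finset.mem_range.mp hj
    exact sum_baileyTerm_eq_zero hq1 _ (by omega)

/-! ### The conjugate Bailey pair from the `q`-Gauss sum. -/

theorem qPochInf_eq_mul (x : ℂ) {q : ℂ} (hq1 : ‖q‖ < 1) (n : ℕ) :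
    qPochInf x q = qPoch x q n * qPochInf (x * q ^ n) q := by
  have h1 := (tendsto_qPoch x hq1).comp (tendsto_add_atTop_nat n)
  refine tendsto_nhds_unique h1 (((tendsto_qPoch (x * q ^ n) hq1).const_mul _).congr fun m => ?_)
  rw [Function.comp_apply, add_comm m n, qPoch_add]

theorem qPoch_succ' (x q : ℂ) (n : ℕ) :
    qPoch x q (n + 1) = (1 - x) * qPoch (x * q) q n := by
  rw [add_comm n 1, qPoch_add, qPoch_succ, qPoch_zero]
  simp

/-- An indefinite form of the `q`-Gauss sum. -/
theorem sum_qGauss {a b q : ℂ} (hq1 : ‖q‖ < 1) {c : ℕ} (hab : a * b = q ^ c) (M : ℕ) :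
    ∑ m ∈ Finset.range (M + 1),
      qPoch a q m * qPoch b q m * q ^ m * ((qPoch q q m)⁻¹ * (qPoch q q (c + m))⁻¹) =
    qPoch (a * q) q M * qPoch (b * q) q M * ((qPoch q q M)⁻¹ * (qPoch q q (c + M))⁻¹) := by
  induction M with
  | zero => simp [qPoch_zero]
  | succ M ih =>
    rw [Finset.sum_range_succ, ih, qPoch_succ' a, qPoch_succ' b, qPoch_succ (a * q),
      qPoch_succ (b * q), ← add_assoc, qPoch_self_succ q M, qPoch_self_succ q (c + M)]
    have h1 := qPoch_self_ne_zero hq1 M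
    have h2 := one_sub_pow_succ_ne_zero hq1 M
    have h3 := qPoch_self_ne_zero hq1 (c + M)
    have h4 := one_sub_pow_succ_ne_zero hq1 (c + M)
    -- The only place where `a b = q^c` enters; with it the induction step becomes a rational
    -- identity.
    have h5 : q ^ (c + M + 1) = a * b * q ^ (M + 1) := by rw [hab, add_assoc, pow_add]
    rw [h5] at h4 ⊢
    field_simp
    ring

theorem hasSum_qGauss {a b q : ℂ} (hq1 : ‖q‖ < 1) {c : ℕ} (hab : a * b = q ^ c) :
    HasSum (fun m =>
      qPoch a q m * qPoch b q m * q ^ m * ((qPoch q q m)⁻¹ * (qPoch q q (c + m))⁻¹))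
      (qPochInf (a * q) q * qPochInf (b * q) q * (qPochInf q q ^ 2)⁻¹) := by
  obtain ⟨C, hC0, hC⟩ := exists_norm_inv_qPoch_le hq1
  have hs : Summable fun m =>
      qPoch a q m * qPoch b q m * q ^ m * ((qPoch q q m)⁻¹ * (qPoch q q (c + m))⁻¹) := by
    refine Summable.of_norm_bounded (((summable_geometric_of_lt_one (norm_nonneg q) hq1).mul_left
      (Real.exp (‖a‖ / (1 - ‖q‖)) * Real.exp (‖b‖ / (1 - ‖q‖)))).mul_right (C * C)) fun m => ?_
    simp only [norm_mul, norm_pow]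
    gcongr
    · exact norm_qPoch_le a hq1 m
    · exact norm_qPoch_le b hq1 m
    · exact hC _
    · exact hC _
  have hne := qPochInf_self_ne_zero hq1
  have hP := (tendsto_qPoch q hq1).inv₀ hne
  have hPc : Tendsto (fun M => (qPoch q q (c + M))⁻¹) atTop (𝓝 (qPochInf q q)⁻¹) :=
    (hP.comp (tendsto_add_atTop_nat c)).congr fun M => by rw [Function.comp_apply, add_comm]
  have hlim := ((tendsto_qPoch (a * q) hq1).mul (tendsto_qPoch (b * q) hq1)).mul (hP.mul hPc)
  have h := tendsto_nhds_unique (hs.hasSum.tendsto_sum_nat.comp (tendsto_add_atTop_nat 1))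
    (hlim.congr fun M => (sum_qGauss hq1 hab M).symm)
  rw [sq, mul_inv, ← h]
  exact hs.hasSum

theorem hasSum_conjugate_bailey {x q : ℂ} (hq1 : ‖q‖ < 1) (hx : x ≠ 0) (r : ℕ)
    (h1 : 1 - x * q ^ r ≠ 0) (h2 : 1 - q / x * q ^ r ≠ 0) :
    HasSum (fun m => q ^ (m + r) * (qPoch x q (m + r) * qPoch (q / x) q (m + r)) *
        ((qPoch q q m)⁻¹ * (qPoch q q (2 * r + 1 + m))⁻¹))
      (qPochInf x q * qPochInf (q / x) q * (qPochInf q q ^ 2)⁻¹ *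
        (q ^ r / ((1 - x * q ^ r) * (1 - q / x * q ^ r)))) := by
  -- Splitting off the first `r` factors leaves the `q`-Gauss sum with `a = x q^r`, `b = q^(r+1)/x`,
  -- `c = 2r + 1`.
  have hab : (x * q ^ r) * (q / x * q ^ r) = q ^ (2 * r + 1) := by
    field_simp
    ring
  refine hasSum_of_eq ((hasSum_qGauss hq1 hab).mul_left
    (q ^ r * (qPoch x q r * qPoch (q / x) q r))) (fun m => ?_) ?_
  · rw [add_comm m r, qPoch_add, qPoch_add, pow_add]; ring
  · rw [qPochInf_eq_mul x hq1 (r + 1), qPochInf_eq_mul (q / x) hq1 (r + 1), qPoch_succ, qPoch_succ,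
      pow_succ, ← mul_assoc, ← mul_assoc]
    generalize qPochInf q q ^ 2 = z
    generalize 1 - x * q ^ r = u at h1 ⊢
    generalize 1 - q / x * q ^ r = v at h2 ⊢
    field_simp

/-- Bailey's transform: insert `1 = β_n` in the form `sum_alpha` into each term of `𝒰` and sum over
`n` first. -/
theorem U_eq_tsum_alpha {x q : ℂ} (hq : q ≠ 0) (hq1 : ‖q‖ < 1) (hx : x ≠ 0)
    (hα : Summable (alpha q)) (h1 : ∀ r : ℕ, 1 - x * q ^ r ≠ 0)
    (h2 : ∀ r : ℕ, 1 - q / x * q ^ r ≠ 0) :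
    U 1 1 (-x) q = qPochInf x q * qPochInf (q / x) q * (qPochInf q q ^ 2)⁻¹ *
      ∑' r, alpha q r * (q ^ r / ((1 - x * q ^ r) * (1 - q / x * q ^ r))) := by
  obtain ⟨C, hC0, hC⟩ := exists_norm_inv_qPoch_le hq1
  set F : ℕ → ℕ → ℂ := fun n r => if r ≤ n then
    alpha q r * (q ^ n * (qPoch x q n * qPoch (q / x) q n) *
      ((qPoch q q (n - r))⁻¹ * (qPoch q q (n + r + 1))⁻¹)) else 0 with hF
  set E := Real.exp (‖x‖ / (1 - ‖q‖)) * Real.exp (‖q / x‖ / (1 - ‖q‖)) with hE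
  have hsum : Summable (Function.uncurry F) := by
    refine Summable.of_norm_bounded (((summable_geometric_of_lt_one (norm_nonneg q)
      hq1).mul_of_nonneg hα.norm (fun _ => by positivity)
      (fun _ => norm_nonneg _)).mul_right (E * (C * C))) fun ⟨n, r⟩ => ?_
    simp only [Function.uncurry, hF]
    split_ifs with h
    · simp only [norm_mul, norm_pow]
      calc _ = ‖q‖ ^ n * ‖alpha q r‖ * ((‖qPoch x q n‖ * ‖qPoch (q / x) q n‖) *
            (‖(qPoch q q (n - r))⁻¹‖ * ‖(qPoch q q (n + r + 1))⁻¹‖)) := by ring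
        _ ≤ _ := by
          gcongr
          · exact mul_le_mul (norm_qPoch_le x hq1 n) (norm_qPoch_le (q / x) hq1 n)
              (norm_nonneg _) (by positivity)
          · exact hC _
          · exact hC _
    · rw [norm_zero]; positivity
  have hrow : ∀ n, ∑' r, F n r = UTerm 1 1 (-x) q n := by
    intro n
    rw [tsum_eq_sum (f := F n) (s := Finset.range (n + 1))
      (fun r hr => if_neg (by rw [Finset.mem_range] at hr; omega)), UTerm_one]
    have h := congrArg (q ^ n * (qPoch x q n * qPoch (q / x) q n) * ·) (sum_alpha hq hq1 n)
    simp only [mul_one, Finset.mul_sum] at h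
    rw [← h]
    refine Finset.sum_congr rfl fun r hr => ?_
    simp only [hF]
    rw [if_pos (by rw [Finset.mem_range] at hr; omega)]
    ring
  have hcol : ∀ r, ∑' n, F n r = qPochInf x q * qPochInf (q / x) q * (qPochInf q q ^ 2)⁻¹ *
      (alpha q r * (q ^ r / ((1 - x * q ^ r) * (1 - q / x * q ^ r)))) := by
    intro r
    have h := (hasSum_conjugate_bailey hq1 hx r (h1 r) (h2 r)).mul_left (alpha q r)
    have h0 : ∑ n ∈ Finset.range r, F n r = 0 :=
      Finset.sum_eq_zero fun n hn => if_neg (by rw [Finset.mem_range] at hn; omega)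
    have h' := (hasSum_nat_add_iff (f := fun n => F n r) r).mp (hasSum_of_eq h (fun m => by
      rw [hF]
      simp only
      rw [if_pos (by omega), show m + r - r = m by omega,
        show m + r + r + 1 = 2 * r + 1 + m by ring]) rfl)
    rw [h0, add_zero] at h'
    rw [h'.tsum_eq]
    ring
  rw [U, ← tsum_congr hrow, ← hsum.tsum_comm, ← tsum_mul_left]
  exact tsum_congr hcol

/-- Dominated convergence as `n → ∞` in `sum_alpha`, where each reciprocal Pochhammer symbol tends
to `1/(q)_∞`. -/
theorem tsum_alpha {q : ℂ} (hq : q ≠ 0) (hq1 : ‖q‖ < 1) (hα : Summable (alpha q)) :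
    ∑' r, alpha q r = qPochInf q q ^ 2 := by
  obtain ⟨C, hC0, hC⟩ := exists_norm_inv_qPoch_le hq1
  have hne := qPochInf_self_ne_zero hq1
  have hP := (tendsto_qPoch q hq1).inv₀ hne
  set F : ℕ → ℕ → ℂ := fun n r => if r ≤ n then
    alpha q r * ((qPoch q q (n - r))⁻¹ * (qPoch q q (n + r + 1))⁻¹) else 0 with hF
  have hlim : Tendsto (fun n => ∑' r, F n r) atTop
      (𝓝 (∑' r, alpha q r * ((qPochInf q q)⁻¹ * (qPochInf q q)⁻¹))) := by
    refine tendsto_tsum_of_dominated_convergence (hα.norm.mul_right (C * C)) (fun r => ?_)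
      (Eventually.of_forall fun n r => ?_)
    · have h1 := (hP.comp (tendsto_sub_atTop_nat r)).mul (hP.comp (tendsto_add_atTop_nat (r + 1)))
      refine (h1.const_mul (alpha q r)).congr' ?_
      filter_upwards [eventually_ge_atTop r] with n hn
      simp only [hF]
      rw [if_pos hn]
      rfl
    · simp only [hF]
      split_ifs
      · simp only [norm_mul]
        gcongr
        · exact hC _
        · exact hC _
      · rw [norm_zero]; positivity
  have hrow : ∀ n, ∑' r, F n r = 1 := by
    intro n
    rw [tsum_eq_sum (f := F n) (s := Finset.range (n + 1))
      (fun r hr => if_neg (by rw [Finset.mem_range] at hr; omega)), ← sum_alpha hq hq1 n]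
    refine Finset.sum_congr rfl fun r hr => ?_
    simp only [hF]
    rw [if_pos (by rw [Finset.mem_range] at hr; omega)]
  have h := tendsto_nhds_unique hlim (tendsto_const_nhds.congr fun n => (hrow n).symm)
  rw [tsum_mul_right] at h
  field_simp at h
  exact h

/-! ### Indefinite theta series in diagonal coordinates. -/

/-- The terms of an indefinite theta series of the shape of `g_{2,1}` and `θ_{1,1}`, with a
weight `φ` depending on `(r + s) / 2`. -/
noncomputable def pairTerm (q : ℂ) (φ : ℤ → ℂ) (p : ℤ × ℤ) : ℂ :=
  sg₂ (p.1 + p.2) (p.1 - p.2) * (-1) ^ p.2 *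
    q ^ (2 * p.1 ^ 2 + 2 * p.1 - (tri p.2 + p.2 ^ 2)) * φ p.1

theorem summable_pow_natAbs {r : ℝ} (hr0 : 0 ≤ r) (hr1 : r < 1) :
    Summable fun k : ℤ => r ^ k.natAbs := by
  have h := summable_geometric_of_lt_one hr0 hr1
  apply Summable.of_nat_of_neg_add_one
  · simpa using h
  · refine (h.mul_right r).congr fun n => ?_
    rw [← pow_succ]
    congr 1

theorem sg₂_eq_zero_of_notMem {n : ℕ} {j : ℤ} (hj : j ∉ Finset.Icc (-(n : ℤ)) n) :
    sg₂ (n + j) (n - j) = 0 := by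
  rw [Finset.mem_Icc, not_and_or, not_le, not_le] at hj
  rcases hj with hj | hj
  · exact sg₂_of_neg_of_nonneg (by omega) (by omega)
  · exact sg₂_of_nonneg_of_neg (by omega) (by omega)

theorem sg₂_eq_zero_of_notMem' {n : ℕ} {j : ℤ} (hj : j ∉ Finset.Icc (-(n : ℤ)) n) :
    sg₂ (-((n : ℤ) + 1) + j) (-((n : ℤ) + 1) - j) = 0 := by
  rw [Finset.mem_Icc, not_and_or, not_le, not_le] at hj
  rcases hj with hj | hj
  · exact sg₂_of_neg_of_nonneg (by omega) (by omega)
  · exact sg₂_of_nonneg_of_neg (by omega) (by omega)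

theorem hasSum_pairTerm_nat (q : ℂ) (hq : q ≠ 0) (φ : ℤ → ℂ) (n : ℕ) :
    HasSum (fun j => pairTerm q φ ((n : ℤ), j))
      (q ^ (2 * n ^ 2 + 2 * n) * truncTheta q n * φ n) := by
  have h := hasSum_sum_of_ne_finset_zero (f := fun j => pairTerm q φ ((n : ℤ), j))
    (s := Finset.Icc (-(n : ℤ)) n) (L := .unconditional ℤ)
    (fun j hj => by simp only [pairTerm]; rw [sg₂_eq_zero_of_notMem hj]; ring)
  refine hasSum_of_eq h (fun _ => rfl) ?_
  rw [truncTheta, Finset.mul_sum, Finset.sum_mul]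
  refine Finset.sum_congr rfl fun j hj => ?_
  rw [Finset.mem_Icc] at hj
  simp only [pairTerm]
  rw [sg₂_of_nonneg (by omega) (by omega), sub_eq_add_neg, zpow_add₀ hq, ← zpow_natCast]
  push_cast
  ring

theorem hasSum_pairTerm_neg (q : ℂ) (hq : q ≠ 0) (φ : ℤ → ℂ) (n : ℕ) :
    HasSum (fun j => pairTerm q φ (-((n : ℤ) + 1), j))
      (-(q ^ (2 * n ^ 2 + 2 * n) * truncTheta q n * φ (-((n : ℤ) + 1)))) := by
  have h := hasSum_sum_of_ne_finset_zero (f := fun j => pairTerm q φ (-((n : ℤ) + 1), j))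
    (s := Finset.Icc (-(n : ℤ)) n) (L := .unconditional ℤ)
    (fun j hj => by simp only [pairTerm]; rw [sg₂_eq_zero_of_notMem' hj]; ring)
  refine hasSum_of_eq h (fun _ => rfl) ?_
  rw [truncTheta, Finset.mul_sum, Finset.sum_mul, ← Finset.sum_neg_distrib]
  refine Finset.sum_congr rfl fun j hj => ?_
  rw [Finset.mem_Icc] at hj
  simp only [pairTerm]
  rw [sg₂_of_neg (by omega) (by omega), sub_eq_add_neg (2 * _ ^ 2 + _), zpow_add₀ hq,
    ← zpow_natCast,
    show 2 * (-((n : ℤ) + 1)) ^ 2 + 2 * -((n : ℤ) + 1) = ((2 * n ^ 2 + 2 * n : ℕ) : ℤ) by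
      push_cast; ring]
  ring

/-- The form is positive on the cone `|j| ≤ n`. The `-|n|` on the right reserves room for a weight
growing like `‖q‖^(-|n|)`. In the worst case `j = -n` the inequality reads `(2n-3)^2 + 15 ≥ 0`. -/
theorem exponent_bound_of_nonneg {n j : ℤ} (h1 : -n ≤ j) (h2 : j ≤ n) :
    |n| + |j| - 3 ≤ 2 * n ^ 2 + 2 * n - (tri j + j ^ 2) - |n| := by
  have ht := two_mul_tri j
  have hn : 0 ≤ n := by omega
  rw [abs_of_nonneg hn]
  rcases abs_cases j with ⟨h, _⟩ | ⟨h, _⟩ <;> rw [h] <;> nlinarith [sq_nonneg (2 * n - 3)]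

theorem exponent_bound_of_neg {n j : ℤ} (h1 : n + 1 ≤ j) (h2 : j ≤ -n - 1) :
    |n| + |j| - 3 ≤ 2 * n ^ 2 + 2 * n - (tri j + j ^ 2) - |n| := by
  have ht := two_mul_tri j
  obtain ⟨m, rfl⟩ : ∃ m, n = -m - 1 := ⟨-n - 1, by ring⟩
  have hm : 0 ≤ m := by omega
  rw [abs_of_nonpos (by omega : -m - 1 ≤ 0)]
  rcases abs_cases j with ⟨h, _⟩ | ⟨h, _⟩ <;> rw [h] <;> nlinarith [sq_nonneg (2 * m - 3)]

theorem exponent_bound {n j : ℤ} (h : sg₂ (n + j) (n - j) ≠ 0) :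
    |n| + |j| - 3 ≤ 2 * n ^ 2 + 2 * n - (tri j + j ^ 2) - |n| := by
  rcases le_or_gt 0 n with hn | hn
  · obtain ⟨m, rfl⟩ := Int.eq_ofNat_of_zero_le hn
    have hj := Finset.mem_Icc.mp (not_imp_comm.mp sg₂_eq_zero_of_notMem h)
    exact exponent_bound_of_nonneg hj.1 hj.2
  · obtain ⟨m, rfl⟩ : ∃ m : ℕ, n = -((m : ℤ) + 1) := ⟨(-n - 1).toNat, by omega⟩
    have hj := Finset.mem_Icc.mp (not_imp_comm.mp sg₂_eq_zero_of_notMem' h)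
    exact exponent_bound_of_neg (by omega) (by omega)

theorem summable_pairTerm {q : ℂ} (hq : q ≠ 0) (hq1 : ‖q‖ < 1) {φ : ℤ → ℂ} {C : ℝ}
    (hφ : ∀ n, ‖φ n‖ * ‖q‖ ^ n.natAbs ≤ C) : Summable (pairTerm q φ) := by
  have hq' : 0 < ‖q‖ := norm_pos_iff.mpr hq
  have hs := summable_pow_natAbs hq'.le hq1
  have hC : 0 ≤ C := le_trans (by positivity) (hφ 0)
  refine Summable.of_norm_bounded (((hs.mul_of_nonneg hs (fun _ => by positivity)
    (fun _ => by positivity)).mul_right (‖q‖ ^ (-3 : ℤ))).mul_right C) fun ⟨n, j⟩ => ?_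
  by_cases h : sg₂ (n + j) (n - j) = 0
  · simp only [pairTerm, h, zero_mul, norm_zero]
    positivity
  simp only [pairTerm, norm_mul, norm_zpow, norm_neg, norm_one, one_zpow, mul_one]
  have e : ‖q‖ ^ (2 * n ^ 2 + 2 * n - (tri j + j ^ 2)) =
      ‖q‖ ^ (2 * n ^ 2 + 2 * n - (tri j + j ^ 2) - |n|) * ‖q‖ ^ n.natAbs := by
    rw [← zpow_natCast, ← zpow_add₀ hq'.ne', Int.natCast_natAbs, sub_add_cancel]
  have e' : ‖q‖ ^ n.natAbs * ‖q‖ ^ j.natAbs * ‖q‖ ^ (-3 : ℤ) = ‖q‖ ^ (|n| + |j| - 3) := by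
    rw [← zpow_natCast, ← zpow_natCast, ← zpow_add₀ hq'.ne', ← zpow_add₀ hq'.ne',
      Int.natCast_natAbs, Int.natCast_natAbs, ← sub_eq_add_neg]
  rw [e, e']
  calc _ = ‖sg₂ (n + j) (n - j)‖ * ‖q‖ ^ (2 * n ^ 2 + 2 * n - (tri j + j ^ 2) - |n|) *
        (‖φ n‖ * ‖q‖ ^ n.natAbs) := by ring
    _ ≤ 1 * ‖q‖ ^ (|n| + |j| - 3) * C := by
        have hz := zpow_le_zpow_right_of_le_one₀ hq' hq1.le (exponent_bound h)
        exact mul_le_mul (mul_le_mul (norm_sg₂_le _ _) hz (by positivity) one_pos.le) (hφ n)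
          (by positivity) (by positivity)
    _ = _ := by rw [one_mul]

/-- The exponent `2n^2 + 2n` is invariant under `n ↦ -n-1`, while the sign factor flips, so these
rows combine into a difference of weights. -/
theorem hasSum_pairTerm {q : ℂ} (hq : q ≠ 0) {φ : ℤ → ℂ} (hs : Summable (pairTerm q φ)) :
    HasSum (fun n : ℕ => q ^ (2 * n ^ 2 + 2 * n) * truncTheta q n * (φ n - φ (-((n : ℤ) + 1))))
      (∑' p, pairTerm q φ p) := by
  have hrow : ∀ n : ℤ, Summable fun j => pairTerm q φ (n, j) := fun n => hs.prod_factor n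
  have h := (hs.hasSum.prod_fiberwise fun n => (hrow n).hasSum).nat_add_neg_add_one
  refine hasSum_of_eq h (fun n => ?_) rfl
  rw [(hasSum_pairTerm_nat q hq φ n).tsum_eq, (hasSum_pairTerm_neg q hq φ n).tsum_eq]
  ring

/-- Here `j` has the sign opposite to that in `gTerm_comp`; this makes the two exponents agree up to
the weight `q^(-n)`. -/
theorem thetaTerm_comp (q : ℂ) (hq : q ≠ 0) (p : ℤ × ℤ) :
    thetaTerm 2 1 1 q (p.1 - p.2, p.1 + p.2) = pairTerm q (fun n => q ^ (-n)) p := by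
  obtain ⟨n, j⟩ := p
  have hc : n - j ≡ n + j [ZMOD 2] := (Int.modEq_iff_dvd).mpr ⟨j, by ring⟩
  have hB := eight_mul_B 2 1 1 hc
  have e : B 2 1 1 (n - j) (n + j) = 2 * n ^ 2 + 2 * n - (tri j + j ^ 2) + -n := by
    linarith [two_mul_tri j]
  have e2 : (n - j - (n + j)) / 2 = -j := by omega
  simp only [thetaTerm, pairTerm]
  rw [if_pos hc, e, e2, zpow_add₀ hq _ (-n), zpow_neg (-1 : ℂ), ← inv_zpow, inv_neg_one,
    show sg₂ (n - j) (n + j) = sg₂ (n + j) (n - j) by rw [sg₂, sg₂, add_comm]]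
  ring

theorem gTerm_comp (x q : ℂ) (p : ℤ × ℤ) :
    gTerm 2 1 x q (p.1 + p.2, p.1 - p.2) = pairTerm q (fun n => (1 - x * q ^ n)⁻¹) p := by
  obtain ⟨n, j⟩ := p
  have hc : n + j ≡ n - j [ZMOD 2] := (Int.modEq_iff_dvd).mpr ⟨-j, by ring⟩
  have hB := eight_mul_B 2 2 1 hc
  have e : B 2 2 1 (n + j) (n - j) = 2 * n ^ 2 + 2 * n - (tri j + j ^ 2) := by
    linarith [two_mul_tri j]
  have e2 : (n + j - (n - j)) / 2 = j := by omega
  have e3 : (n + j + (n - j)) / 2 = n := by omega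
  simp only [gTerm, pairTerm]
  rw [if_pos hc, e, e2, e3]
  ring

theorem injective_add_sub : Function.Injective fun p : ℤ × ℤ => (p.1 + p.2, p.1 - p.2) := by
  rintro ⟨a, b⟩ ⟨c, d⟩ h
  simp only [Prod.mk.injEq] at h ⊢
  omega

theorem injective_sub_add : Function.Injective fun p : ℤ × ℤ => (p.1 - p.2, p.1 + p.2) := by
  rintro ⟨a, b⟩ ⟨c, d⟩ h
  simp only [Prod.mk.injEq] at h ⊢
  omega

theorem thetaTerm_eq_zero_of_notMem (q : ℂ) (p : ℤ × ℤ)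
    (hp : p ∉ Set.range fun p : ℤ × ℤ => (p.1 - p.2, p.1 + p.2)) : thetaTerm 2 1 1 q p = 0 := by
  refine if_neg fun hc => hp ?_
  obtain ⟨d, hd⟩ := hc.dvd
  exact ⟨(p.1 + d, d), Prod.ext (by simp) (by simp only; linarith)⟩

theorem gTerm_eq_zero_of_notMem (x q : ℂ) (p : ℤ × ℤ)
    (hp : p ∉ Set.range fun p : ℤ × ℤ => (p.1 + p.2, p.1 - p.2)) : gTerm 2 1 x q p = 0 := by
  refine if_neg fun hc => hp ?_
  obtain ⟨d, hd⟩ := hc.dvd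
  exact ⟨(p.1 + d, -d), Prod.ext (by simp) (by simp only; linarith)⟩

theorem summable_pairTerm_zpow_neg {q : ℂ} (hq : q ≠ 0) (hq1 : ‖q‖ < 1) :
    Summable (pairTerm q fun n => q ^ (-n)) := by
  have hq' : 0 < ‖q‖ := norm_pos_iff.mpr hq
  refine summable_pairTerm (C := 1) hq hq1 fun n => ?_
  rw [norm_zpow, ← zpow_natCast, ← zpow_add₀ hq'.ne', Int.natCast_natAbs]
  exact zpow_le_one₀ hq' hq1.le (by linarith [le_abs_self n])

theorem summable_thetaTerm {q : ℂ} (hq : q ≠ 0) (hq1 : ‖q‖ < 1) :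
    Summable (thetaTerm 2 1 1 q) := by
  rw [← injective_sub_add.summable_iff (thetaTerm_eq_zero_of_notMem q)]
  exact (summable_pairTerm_zpow_neg hq hq1).congr fun p => (thetaTerm_comp q hq p).symm

/-- The weight difference `q^(-n) - q^(n+1)` supplies the factor `1 - q^(2n+1)` of `alpha`. This
also provides the summability of `alpha` assumed earlier. -/
theorem hasSum_alpha {q : ℂ} (hq : q ≠ 0) (hq1 : ‖q‖ < 1) :
    HasSum (alpha q) (theta 2 1 1 q) := by
  have h := hasSum_pairTerm hq (summable_pairTerm_zpow_neg hq hq1)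
  refine hasSum_of_eq h (fun n => ?_) ?_
  · have e : q ^ (2 * n ^ 2 + 2 * n) * q ^ (-(n : ℤ)) = q ^ (2 * n ^ 2 + n) := by
      rw [← zpow_natCast, ← zpow_natCast, ← zpow_add₀ hq]; congr 1; push_cast; ring
    have e' : q ^ (-(-((n : ℤ) + 1))) = q ^ (n + 1) := by
      rw [neg_neg]; exact_mod_cast rfl
    rw [alpha, e']
    linear_combination -truncTheta q n * e
  · rw [theta, ← injective_sub_add.tsum_eq]
    · exact tsum_congr fun p => thetaTerm_comp q hq p
    · intro p hp
      by_contra h0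
      exact hp (thetaTerm_eq_zero_of_notMem q p h0)

theorem theta_eq {q : ℂ} (hq : q ≠ 0) (hq1 : ‖q‖ < 1) :
    theta 2 1 1 q = qPochInf q q ^ 2 := by
  have h := hasSum_alpha hq hq1
  rw [← h.tsum_eq, tsum_alpha hq hq1 h.summable]

/-- The sequence converges at both ends, after rewriting it as `q^m / (q^m - x)` for `n = -m`. A
vanishing denominator does no harm, since its inverse is 0 by convention. -/
theorem exists_norm_inv_one_sub_le {x q : ℂ} (hq : q ≠ 0) (hq1 : ‖q‖ < 1) (hx : x ≠ 0) :
    ∃ C : ℝ, ∀ n : ℤ, ‖(1 - x * q ^ n)⁻¹‖ ≤ C := by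
  have hpow := tendsto_pow_atTop_nhds_zero_of_norm_lt_one hq1
  have h1 : Tendsto (fun n : ℕ => (1 - x * q ^ n)⁻¹) atTop (𝓝 (1 - x * 0)⁻¹) :=
    (tendsto_const_nhds.sub (hpow.const_mul x)).inv₀ (by simp)
  have h2 : Tendsto (fun n : ℕ => q ^ n * (q ^ n - x)⁻¹) atTop (𝓝 (0 * (0 - x)⁻¹)) :=
    hpow.mul ((hpow.sub tendsto_const_nhds).inv₀ (by simpa using hx))
  obtain ⟨C1, hC1⟩ := (Metric.isBounded_range_of_tendsto _ h1).exists_norm_le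
  obtain ⟨C2, hC2⟩ := (Metric.isBounded_range_of_tendsto _ h2).exists_norm_le
  refine ⟨max C1 C2, fun n => ?_⟩
  obtain ⟨m, rfl | rfl⟩ := n.eq_nat_or_neg
  · exact (hC1 _ ⟨m, by simp⟩).trans (le_max_left _ _)
  · refine le_trans (le_of_eq ?_) ((hC2 _ ⟨m, rfl⟩).trans (le_max_right _ _))
    have hm := pow_ne_zero m hq
    have e : 1 - x * q ^ (-(m : ℤ)) = (q ^ m - x) * (q ^ m)⁻¹ := by
      rw [zpow_neg, zpow_natCast]; field_simp
    simp only
    rw [e, mul_inv, inv_inv, mul_comm]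

theorem summable_pairTerm_inv {x q : ℂ} (hq : q ≠ 0) (hq1 : ‖q‖ < 1) (hx : x ≠ 0) :
    Summable (pairTerm q fun n => (1 - x * q ^ n)⁻¹) := by
  obtain ⟨C, hC⟩ := exists_norm_inv_one_sub_le hq hq1 hx
  refine summable_pairTerm (C := C) hq hq1 fun n => ?_
  exact (mul_le_of_le_one_right (norm_nonneg _)
    (pow_le_one₀ (norm_nonneg q) hq1.le)).trans (hC n)

theorem summable_gTerm {x q : ℂ} (hq : q ≠ 0) (hq1 : ‖q‖ < 1) (hx : x ≠ 0) :
    Summable (gTerm 2 1 x q) := by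
  rw [← injective_add_sub.summable_iff (gTerm_eq_zero_of_notMem x q)]
  exact (summable_pairTerm_inv hq hq1 hx).congr fun p => (gTerm_comp x q p).symm

/-! ### Partial fractions and the identity with `f_{2,1}`. -/

theorem one_sub_ne_zero_of_ne_zpow {x q : ℂ} (hxq : ∀ k : ℤ, x ≠ q ^ k) (n : ℤ) :
    1 - x * q ^ n ≠ 0 := by
  intro h
  apply hxq (-n)
  rw [zpow_neg]
  exact eq_inv_of_mul_eq_one_left (sub_eq_zero.mp h).symm

theorem one_sub_div_ne_zero_of_ne_zpow {x q : ℂ} (hx : x ≠ 0) (hxq : ∀ k : ℤ, x ≠ q ^ k) (r : ℕ) :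
    1 - q / x * q ^ r ≠ 0 := by
  intro h
  apply hxq ((r + 1 : ℕ) : ℤ)
  have h' := sub_eq_zero.mp h
  field_simp at h'
  rw [zpow_natCast, h']
  ring

theorem g_eq_tsum_alpha {x q : ℂ} (hq : q ≠ 0) (hq1 : ‖q‖ < 1) (hx : x ≠ 0)
    (hxq : ∀ k : ℤ, x ≠ q ^ k) :
    g 2 1 x q = ∑' r, alpha q r * (q ^ r / ((1 - x * q ^ r) * (1 - q / x * q ^ r))) := by
  have h := hasSum_pairTerm hq (summable_pairTerm_inv hq hq1 hx)
  have e : g 2 1 x q = ∑' p, pairTerm q (fun n => (1 - x * q ^ n)⁻¹) p := by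
    rw [g, ← injective_add_sub.tsum_eq]
    · exact tsum_congr fun p => gTerm_comp x q p
    · intro p hp
      by_contra h0
      exact hp (gTerm_eq_zero_of_notMem x q p h0)
  rw [e, ← h.tsum_eq]
  refine tsum_congr fun r => ?_
  have h1 := one_sub_ne_zero_of_ne_zpow hxq r
  have h2 := one_sub_ne_zero_of_ne_zpow hxq (-((r : ℤ) + 1))
  have h3 := one_sub_div_ne_zero_of_ne_zpow hx hxq r
  have hr : q ^ (-((r : ℤ) + 1)) = (q * q ^ r)⁻¹ := by
    rw [zpow_neg, ← pow_succ']; exact_mod_cast rfl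
  have hqr := pow_ne_zero r hq
  -- With `u = x q^r` and `v = q^(r+1)/x` the weight difference is `1/(1-u) + v/(1-v) =
  -- (1-uv)/((1-u)(1-v))`, and `uv = q^(2r+1)`.
  have h4 : (1 - x * (q * q ^ r)⁻¹)⁻¹ = -(q / x * q ^ r) / (1 - q / x * q ^ r) := by
    rw [hr] at h2
    rw [inv_eq_iff_eq_inv, inv_div, eq_div_iff (by
      exact neg_ne_zero.mpr (mul_ne_zero (div_ne_zero hq hx) hqr))]
    field_simp
    ring
  have h5 : q ^ (2 * r + 1) = (x * q ^ r) * (q / x * q ^ r) := by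
    field_simp; ring
  rw [hr, h4, alpha, h5, zpow_natCast, show 2 * r ^ 2 + 2 * r = 2 * r ^ 2 + r + r by ring,
    pow_add q (2 * r ^ 2 + r) r]
  rw [zpow_natCast] at h1
  generalize x * q ^ r = u at h1 ⊢
  generalize q / x * q ^ r = v at h3 ⊢
  field_simp
  ring

theorem U_eq_f {x q : ℂ} (hq : q ≠ 0) (hq1 : ‖q‖ < 1) (hx : x ≠ 0)
    (hxq : ∀ k : ℤ, x ≠ q ^ k) : U 1 1 (-x) q = f 2 1 x q := by
  have hne := qPochInf_self_ne_zero hq1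
  rw [U_eq_tsum_alpha hq hq1 hx (hasSum_alpha hq hq1).summable
    (fun r => by simpa using one_sub_ne_zero_of_ne_zpow hxq r)
    (one_sub_div_ne_zero_of_ne_zpow hx hxq), f, g_eq_tsum_alpha hq hq1 hx hxq, Theta]
  field_simp

/-! ### Removable singularities. -/

theorem continuousAt_U {x q : ℂ} (hq1 : ‖q‖ < 1) (hx : x ≠ 0) :
    ContinuousAt (fun y => U 1 1 (-y) q) x := by
  have hx' : 0 < ‖x‖ := norm_pos_iff.mpr hx
  have hq2 : 0 < 1 - ‖q‖ := sub_pos.mpr hq1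
  -- On an annulus away from 0 both `‖y‖` and `‖q / y‖` are bounded, so the series converges
  -- uniformly.
  set s : Set ℂ := {y | ‖x‖ / 2 < ‖y‖ ∧ ‖y‖ < 2 * ‖x‖} with hs
  have hopen : IsOpen s :=
    (isOpen_lt continuous_const continuous_norm).inter (isOpen_lt continuous_norm continuous_const)
  have hmem : x ∈ s := ⟨by linarith, by linarith⟩
  refine ContinuousOn.continuousAt (s := s) ?_ (hopen.mem_nhds hmem)
  refine continuousOn_tsum (u := fun n => ‖q‖ ^ n * (Real.exp (2 * ‖x‖ / (1 - ‖q‖)) *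
    Real.exp (‖q‖ / (‖x‖ / 2) / (1 - ‖q‖)))) (fun n => ?_)
    ((summable_geometric_of_lt_one (norm_nonneg q) hq1).mul_right _) fun n y hy => ?_
  · simp only [UTerm_one, qPoch]
    have hne : ∀ y ∈ s, y ≠ 0 := fun y hy => norm_pos_iff.mp (by linarith [hy.1])
    fun_prop (disch := assumption)
  · refine (norm_UTerm_one_le y hq1 n).trans ?_
    have h1 : ‖x‖ / 2 < ‖y‖ := hy.1
    have h2 : ‖y‖ < 2 * ‖x‖ := hy.2
    rw [norm_div]
    gcongr

theorem eventually_ne_zpow {x q : ℂ} (hq : q ≠ 0) (hq1 : ‖q‖ < 1) (hx : x ≠ 0) :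
    ∀ᶠ y in 𝓝[≠] x, ∀ k : ℤ, y ≠ q ^ k := by
  have hq' : 0 < ‖q‖ := norm_pos_iff.mpr hq
  have hx' : 0 < ‖x‖ := norm_pos_iff.mpr hx
  -- Powers `q^k` with `k > m` or `k < -l` fall outside the annulus, leaving finitely many to avoid.
  obtain ⟨m, hm⟩ := exists_pow_lt_of_lt_one (show 0 < ‖x‖ / 2 by linarith) hq1
  obtain ⟨l, hl⟩ := exists_pow_lt_of_lt_one (show 0 < (2 * ‖x‖)⁻¹ by positivity) hq1
  have hfin : ∀ᶠ y in 𝓝[≠] x, ∀ k ∈ Finset.Icc (-(l : ℤ)) m, y ≠ q ^ k := by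
    rw [Filter.eventually_all_finset]
    intro k _
    by_cases hk : x = q ^ k
    · rw [← hk]
      exact self_mem_nhdsWithin
    · exact mem_nhdsWithin_of_mem_nhds (isOpen_ne.mem_nhds hk)
  have h1 : ∀ᶠ y in 𝓝[≠] x, ‖x‖ / 2 < ‖y‖ ∧ ‖y‖ < 2 * ‖x‖ :=
    mem_nhdsWithin_of_mem_nhds (((isOpen_lt continuous_const continuous_norm).inter
      (isOpen_lt continuous_norm continuous_const)).mem_nhds ⟨half_lt_self hx', lt_two_mul_self hx'⟩)
  filter_upwards [hfin, h1] with y hy hy' k hk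
  refine hy k (Finset.mem_Icc.mpr ⟨?_, ?_⟩) hk
  · by_contra! h
    have h2 : ‖q‖ ^ (-(l : ℤ)) ≤ ‖y‖ := by
      rw [hk, norm_zpow]
      exact zpow_le_zpow_right_of_le_one₀ hq' hq1.le h.le
    rw [zpow_neg, zpow_natCast] at h2
    have h3 := (lt_inv_comm₀ (by positivity) (by positivity)).mp hl
    linarith [hy'.2]
  · by_contra! h
    have h2 : ‖y‖ ≤ ‖q‖ ^ (m : ℤ) := by
      rw [hk, norm_zpow]
      exact zpow_le_zpow_right_of_le_one₀ hq' hq1.le h.le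
    rw [zpow_natCast] at h2
    linarith [hy'.1]

theorem tendsto_f {x q : ℂ} (hq : q ≠ 0) (hq1 : ‖q‖ < 1) (hx : x ≠ 0) :
    Tendsto (fun y => f 2 1 y q) (𝓝[≠] x) (𝓝 (U 1 1 (-x) q)) := by
  refine ((continuousAt_U hq1 hx).tendsto.mono_left nhdsWithin_le_nhds).congr' ?_
  filter_upwards [eventually_ne_zpow hq hq1 hx,
    mem_nhdsWithin_of_mem_nhds (isOpen_ne.mem_nhds hx)] with y hy hy0
  exact U_eq_f hq hq1 hy0 hy

end UFunction

theorem mainTheorem6 (q x : ℂ) (hq0 : q ≠ 0) (hq1 : ‖q‖ < 1) (hx : x ≠ 0) :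
    -- the series for `𝒰(-x;q)` and the double series `f_{1,2,3}` converge absolutely
    Summable (UFunction.UTerm 1 1 (-x) q) ∧
    Summable (UFunction.heckeTerm 1 2 3 (x⁻¹ * q ^ 2) (q ^ 3) q) ∧
    -- away from the integer powers of `q`, all three functions agree
    ((∀ k : ℤ, x ≠ q ^ k) →
      Summable (UFunction.gTerm 2 1 x q) ∧
      UFunction.U 1 1 (-x) q = UFunction.f 2 1 x q ∧
      UFunction.f 2 1 x q =
        1 / UFunction.qPochInf q q * UFunction.hecke 1 2 3 (x⁻¹ * q ^ 2) (q ^ 3) q) ∧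
    -- at every nonzero point, including the removable singularities `x = q ^ k` of `f_{2,1}`
    UFunction.U 1 1 (-x) q =
      1 / UFunction.qPochInf q q * UFunction.hecke 1 2 3 (x⁻¹ * q ^ 2) (q ^ 3) q ∧
    Filter.Tendsto (fun y : ℂ => UFunction.f 2 1 y q) (nhdsWithin x {x}ᶜ)
      (nhds (UFunction.U 1 1 (-x) q)) ∧
    -- the theta constant `θ_{1,1}` (for `t = 2`)
    Summable (UFunction.thetaTerm 2 1 1 q) ∧
    UFunction.theta 2 1 1 q = UFunction.qPochInf q q ^ 2 := by
  exact ⟨UFunction.summable_UTerm_one x hq1, UFunction.summable_heckeTerm hq0 hq1 hx,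
    fun hxq => ⟨UFunction.summable_gTerm hq0 hq1 hx, UFunction.U_eq_f hq0 hq1 hx hxq,
      (UFunction.U_eq_f hq0 hq1 hx hxq).symm.trans (UFunction.U_eq_hecke hq0 hq1 hx)⟩,
    UFunction.U_eq_hecke hq0 hq1 hx, UFunction.tendsto_f hq0 hq1 hx,
    UFunction.summable_thetaTerm hq0 hq1, UFunction.theta_eq hq0 hq1⟩
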